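/- Let $k\ge 2$. There are a partially ordered set $\mathbb P_*$ of cardinality $\aleph_1$ and $\mathbb P_*$-names $\dot{\mathcal A}$ and $\dot{\mathbb Q}$ such that $\mathbb P_*$ has precalibre-$\aleph_1$, i.e. every uncountable subset of $\mathbb P_*$ has an uncountable subset each finite subset of which has a common lower bound in $\mathbb P_*$, and such that every condition of $\mathbb P_*$ forces the following statements (where $\aleph_1$, identified with the first uncountable ordinal, is the $\aleph_1$ of the ground model, which is also forced to be the $\aleph_1$ of the extension): 1. $\dot{\mathcal A}\subseteq[\aleph_1]^{k+1}$. 2. $\dot{\mathbb Q}=\{v\in[\aleph_1]^{<\aleph_0} : [v]^{k+1}\cap\dot{\mathcal A}=\emptyset\}$, and $\dot{\mathbb Q}$, ordered by $\supseteq$ (a larger set is a stronger condition), is $k$-linked: it can be partitioned into countably many pieces so that any $k$ elements of the same piece have a common lower bound in $\dot{\mathbb Q}$. 3. For every $\alpha<\aleph_1$ the set $\{v\in\dot{\mathbb Q} : v\not\subseteq\alpha\}$ is dense in $\dot{\mathbb Q}$. 4. If $\langle v_\alpha : \alpha<\aleph_1\rangle$ is a sequence with $v_\alpha\in\dot{\mathbb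 Q}$ and $v_\alpha\not\subseteq\alpha$ for all $\alpha<\aleph_1$, and $\langle u_\xi : \xi<\aleph_1\rangle$ is a sequence of non-empty, pairwise disjoint finite subsets of $\aleph_1$, then there are $\xi_0<\dots<\xi_k<\aleph_1$ such that for every $\langle\alpha_\ell : \ell\le k\rangle\in\prod_{\ell\le k}u_{\xi_\ell}$ the set $\bigcup_{\ell\le k}v_{\alpha_\ell}$ does not belong to $\dot{\mathbb Q}$. -/

import Mathlib

/-! Forcing over the universe of types in `Type u`: names for a forcing notion `P`, the forcing
relation for the language of set theory, and the set-theoretic formulas that are needed. -/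

universe u

namespace Forcing

/-- `P` has precalibre-`ℵ₁`: every uncountable subset of `P` has an uncountable subset all of whose
finite subsets have a common lower bound. -/
def PrecalibreAlephOne (P : Type u) [PartialOrder P] : Prop :=
  ∀ S : Set P, ¬ S.Countable →
    ∃ T : Set P, T ⊆ S ∧ ¬ T.Countable ∧
      ∀ F : Finset P, (F : Set P) ⊆ T → ∃ r : P, ∀ q ∈ F, r ≤ q

/-- `P`-names: a name is a (small) set of pairs `(σ, r)` with `σ` a `P`-name and `r ∈ P`. -/
inductive PName (P : Type u) : Type (u + 1)
  | mk (ι : Type u) (name : ι → PName P) (cond : ι → P) : PName P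

/-- A sentence of the forcing language, given by the set of the conditions that force it. -/
abbrev Sent (P : Type u) : Type u := P → Prop

section Logic

variable {P : Type u} [PartialOrder P]

/-- `p ⊩ φ ∧ ψ`. -/
def fand (φ ψ : Sent P) : Sent P := fun p => φ p ∧ ψ p

/-- `p ⊩ φ → ψ`: every extension of `p` that forces `φ` forces `ψ`. -/
def fimp (φ ψ : Sent P) : Sent P := fun p => ∀ q ≤ p, φ q → ψ q

/-- `p ⊩ ¬ φ`: no extension of `p` forces `φ`. -/
def fnot (φ : Sent P) : Sent P := fun p => ∀ q ≤ p, ¬ φ q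

/-- `p ⊩ φ ↔ ψ`. -/
def fiff (φ ψ : Sent P) : Sent P := fand (fimp φ ψ) (fimp ψ φ)

/-- `p ⊩ ∀ x, φ x`. With `I` the class of names this is the universal quantifier, with `I` the
class of `n`-tuples of names a block of `n` of them, and with `I` a set (or a proposition) of the
ground model a conjunction. -/
def fall {I : Sort*} (φ : I → Sent P) : Sent P := fun p => ∀ x, φ x p

/-- `p ⊩ ∃ x, φ x`: the conditions that force some `φ x` are dense below `p`. -/
def fex {I : Sort*} (φ : I → Sent P) : Sent P := fun p => ∀ q ≤ p, ∃ r ≤ q, ∃ x, φ x r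

/-- `p ⊩ σ = τ`: whenever `(σ', r) ∈ σ` and `q ≤ p, r`, then `q ⊩ σ' ∈ τ`, and the same with `σ`
and `τ` exchanged (the relation `q ⊩ σ' ∈ τ` is unfolded, see `fmem`). -/
def feq : PName P → PName P → Sent P
  | .mk _ x c, .mk _ y d => fun p =>
      (∀ a, ∀ q ≤ p, q ≤ c a → ∀ r ≤ q, ∃ s ≤ r, ∃ b, s ≤ d b ∧ feq (x a) (y b) s) ∧
      (∀ b, ∀ q ≤ p, q ≤ d b → ∀ r ≤ q, ∃ s ≤ r, ∃ a, s ≤ c a ∧ feq (x a) (y b) s)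

/-- `p ⊩ σ ∈ τ`: the conditions `s` for which there is `(τ', r) ∈ τ` with `s ≤ r` and
`s ⊩ σ = τ'` are dense below `p`. -/
def fmem (σ : PName P) : PName P → Sent P
  | .mk _ y d => fun p => ∀ q ≤ p, ∃ s ≤ q, ∃ b, s ≤ d b ∧ feq σ (y b) s

/-- `⊩ φ`: every condition forces `φ`. -/
def Forced (φ : Sent P) : Prop := ∀ p, φ p

end Logic

infix:50 " ≐ " => feq
infix:50 " ∊ " => fmem
prefix:max "∼" => fnot
infixr:35 " ⋏ " => fand
infixr:25 " ⟹ " => fimp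
infix:20 " ⟺ " => fiff

section Names

variable {P : Type u}

/-- The canonical name of the von Neumann ordinal `α = {β | β < α}` of the ground model. -/
noncomputable def ordName (α : Ordinal.{u}) : PName P :=
  .mk (Shrink.{u} (Set.Iio α) × P) (fun i => ordName ((equivShrink (Set.Iio α)).symm i.1).1)
    Prod.snd
termination_by α
decreasing_by exact ((equivShrink (Set.Iio α)).symm i.1).2

/-- The canonical name of the unordered pair `{σ, τ}`. -/
def upair (σ τ : PName P) : PName P :=
  .mk (ULift.{u} Bool × P) (fun i => if i.1.down then σ else τ) Prod.snd

/-- The canonical name of the Kuratowski pair `(σ, τ) = {{σ}, {σ, τ}}`. -/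
def opair (σ τ : PName P) : PName P := upair (upair σ σ) (upair σ τ)

end Names

section Formulas

variable {P : Type u} [PartialOrder P]

/-- `x ⊆ y`. -/
def fsub (x y : PName P) : Sent P := fall fun z : PName P => z ∊ x ⟹ z ∊ y

/-- `x = {t i | i < n}`. -/
def IsRangeOf {n : ℕ} (x : PName P) (t : Fin n → PName P) : Sent P :=
  fall fun z : PName P => z ∊ x ⟺ fex fun i : Fin n => z ≐ t i

/-- `x` is finite. -/
def IsFin (x : PName P) : Sent P :=
  fex fun n : ℕ => fex fun t : Fin n → PName P => IsRangeOf x t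

/-- `x` has exactly `n` elements. -/
def HasCard (n : ℕ) (x : PName P) : Sent P :=
  fex fun t : Fin n → PName P =>
    (fall fun i => fall fun j => fall fun _ : i ≠ j => ∼(t i ≐ t j)) ⋏ IsRangeOf x t

/-- `s = ⋃ i, w i`. -/
def IsUnionOf {n : ℕ} (s : PName P) (w : Fin n → PName P) : Sent P :=
  fall fun z : PName P => z ∊ s ⟺ fex fun i : Fin n => z ∊ w i

/-- `f` is a function with domain `X`. -/
def IsFunOn (f X : PName P) : Sent P :=
  (fall fun z : PName P => z ∊ f ⟹
    fex fun x : PName P => fex fun y : PName P => x ∊ X ⋏ z ≐ opair x y) ⋏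
  (fall fun x : PName P => x ∊ X ⟹ fex fun y : PName P => opair x y ∊ f) ⋏
  (fall fun x : PName P => fall fun y : PName P => fall fun y' : PName P =>
    opair x y ∊ f ⋏ opair x y' ∊ f ⟹ y ≐ y')

/-- Every value of `f` is in `Y`. -/
def MapsInto (f Y : PName P) : Sent P :=
  fall fun x : PName P => fall fun y : PName P => opair x y ∊ f ⟹ y ∊ Y

/-- `X` is countable: there is an injective function from `X` to `ω`. -/
def IsCountable (X : PName P) : Sent P :=
  fex fun f : PName P => IsFunOn f X ⋏ MapsInto f (ordName Ordinal.omega0) ⋏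
    (fall fun x : PName P => fall fun x' : PName P => fall fun y : PName P =>
      opair x y ∊ f ⋏ opair x' y ∊ f ⟹ x ≐ x')

/-- `X` is a transitive set. -/
def IsTrans (X : PName P) : Sent P := fall fun x : PName P => x ∊ X ⟹ fsub x X

/-- `W = ℵ₁`: `W` is an ordinal, `W` is uncountable, and all its elements are countable. -/
def IsAlephOne (W : PName P) : Sent P :=
  IsTrans W ⋏ (fall fun x : PName P => x ∊ W ⟹ IsTrans x) ⋏ ∼(IsCountable W) ⋏
    (fall fun x : PName P => x ∊ W ⟹ IsCountable x)

/-- `𝒜 ⊆ [W]^n`. -/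
def IsFamilyOfSubsets (n : ℕ) (W 𝒜 : PName P) : Sent P :=
  fall fun a : PName P => a ∊ 𝒜 ⟹ fsub a W ⋏ HasCard n a

/-- `Q = {v ∈ [W]^{<ℵ₀} | [v]^n ∩ 𝒜 = ∅}`. -/
def IsFreeSets (n : ℕ) (W 𝒜 Q : PName P) : Sent P :=
  fall fun v : PName P => v ∊ Q ⟺
    fsub v W ⋏ IsFin v ⋏ (fall fun a : PName P => fsub a v ⋏ HasCard n a ⟹ ∼(a ∊ 𝒜))

/-- The poset `Q`, ordered by `⊇`, is `k`-linked: there is `h : Q → ω` (its fibres are the countably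
many pieces) such that any `k` elements of the same piece have a common lower bound in `Q`. -/
def IsLinked (k : ℕ) (Q : PName P) : Sent P :=
  fex fun h : PName P => IsFunOn h Q ⋏ MapsInto h (ordName Ordinal.omega0) ⋏
    (fall fun w : Fin k → PName P => fall fun n : PName P =>
      (fall fun i => opair (w i) n ∊ h) ⟹
        fex fun r : PName P => r ∊ Q ⋏ fall fun i => fsub (w i) r)

/-- For every `α ∈ W` the set `{v ∈ Q | v ⊈ α}` is dense in the poset `Q`, ordered by `⊇`. -/
def AllDense (W Q : PName P) : Sent P :=
  fall fun α : PName P => α ∊ W ⟹ fall fun v : PName P => v ∊ Q ⟹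
    fex fun w : PName P => w ∊ Q ⋏ ∼(fsub w α) ⋏ fsub v w

/-- `v = ⟨v_α | α ∈ W⟩` with `v_α ∈ Q` and `v_α ⊈ α` for all `α ∈ W`. -/
def IsSelection (W Q v : PName P) : Sent P :=
  IsFunOn v W ⋏ fall fun α : PName P => fall fun x : PName P =>
    opair α x ∊ v ⟹ x ∊ Q ⋏ ∼(fsub x α)

/-- `u = ⟨u_ξ | ξ ∈ W⟩` with the `u_ξ` finite non-empty pairwise disjoint subsets of `W`. -/
def IsDisjointSeq (W u : PName P) : Sent P :=
  IsFunOn u W ⋏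
  (fall fun ξ : PName P => fall fun x : PName P => opair ξ x ∊ u ⟹
    fsub x W ⋏ IsFin x ⋏ fex fun β : PName P => β ∊ x) ⋏
  (fall fun ξ : PName P => fall fun η : PName P => fall fun x : PName P => fall fun y : PName P =>
    opair ξ x ∊ u ⋏ opair η y ∊ u ⋏ ∼(ξ ≐ η) ⟹ ∼(fex fun β : PName P => β ∊ x ⋏ β ∊ y))

/-- For all `v = ⟨v_α | α ∈ W⟩` with `v_α ∈ Q`, `v_α ⊈ α`, and all `u = ⟨u_ξ | ξ ∈ W⟩` with the
`u_ξ` finite non-empty pairwise disjoint subsets of `W`, there are `ξ_0 < ... < ξ_k` in `W` such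
that for all `α_0 ∈ u_{ξ_0}, ..., α_k ∈ u_{ξ_k}` the set `⋃_{ℓ ≤ k} v_{α_ℓ}` is not in `Q`. In the
last part `y ℓ` stands for `u_{ξ_ℓ}`, `w ℓ` for `v_{α_ℓ}`, and `s` for the union. -/
def UnionsAvoid (k : ℕ) (W Q : PName P) : Sent P :=
  fall fun v : PName P => fall fun u : PName P => IsSelection W Q v ⋏ IsDisjointSeq W u ⟹
    fex fun ξ : Fin (k + 1) → PName P =>
      (fall fun i => ξ i ∊ W) ⋏
      (fall fun i => fall fun j => fall fun _ : i < j => ξ i ∊ ξ j) ⋏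
      (fall fun α : Fin (k + 1) → PName P => fall fun y : Fin (k + 1) → PName P =>
        fall fun w : Fin (k + 1) → PName P => fall fun s : PName P =>
          (fall fun i => opair (ξ i) (y i) ∊ u ⋏ α i ∊ y i ⋏ opair (α i) (w i) ∊ v) ⋏
            IsUnionOf s w ⟹ ∼(s ∊ Q))

end Formulas

end Forcing

open Forcing

/-! The poset consists of finite approximations `(dom, fam, lnk)` to the family and to a colouring
of its free sets, subject to the requirement that `k` sets of one colour never cover a member of
`fam`. An extension may add to `fam` only sets not contained in the old domain, so a condition
settles which subsets of its domain are free. Density arguments colour every free set and add points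
above any given ordinal; the requirement on colours makes the generic poset `k`-linked.

Everything else rests on `Cond.exists_amalgam`. Attach distinct reals to the countable ordinals and
replace each point by finitely many digits of its real, enough to separate the domain. This gives
each condition one of countably many codes. Finitely many conditions with the same code have their
union as a common lower bound, because a point shared by two of them has the same digits in both.
Hence the poset is a countable union of centred pieces, which gives precalibre-`ℵ₁` and the
preservation of `ℵ₁`. Moreover, new `(k+1)`-sets may be put into the amalgam, provided that no `k`
sets, each inside one of the given domains, cover such a set.

For the last clause, choose for each `ξ` a condition `q ξ` deciding `u_ξ` and the sets `v_α` for `α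
∈ u_ξ`, and pick in each such `v_α` a point `≥ α`. Among uncountably many `ξ` of one code,
`exists_strictMono_disjoint` finds `k+1` indices such that the picked points of each avoid the
domains of the others. A transversal of the picked points then has at most one point in each domain,
so `k` domains cannot cover it. All transversals may be added to the family, and each union in
question contains one of them. -/

namespace Forcing

/-! ### Calculus of the forcing relation. -/

section Regular

variable {P : Type u} [PartialOrder P]

/-- A sentence is regular if it is inherited by stronger conditions and holds at `p` as soon as it
holds densely below `p`. -/
class Reg (φ : Sent P) : Prop where
  mono : ∀ {p q}, q ≤ p → φ p → φ q
  dense : ∀ {p}, (∀ q ≤ p, ∃ r ≤ q, φ r) → φ p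

/-- With a constant sentence as target, the elimination rules below extract ground-model facts, in
particular contradictions, from forced statements. -/
instance Reg.const (c : Prop) : Reg (fun _ : P => c) :=
  ⟨fun _ h => h, fun {p} h => (h p le_rfl).choose_spec.2⟩

instance Reg.fand (φ ψ : Sent P) [Reg φ] [Reg ψ] : Reg (φ ⋏ ψ) :=
  ⟨fun h hp => ⟨Reg.mono h hp.1, Reg.mono h hp.2⟩,
    fun h => ⟨Reg.dense fun q hq => (h q hq).imp fun _ hr => ⟨hr.1, hr.2.1⟩,
      Reg.dense fun q hq => (h q hq).imp fun _ hr => ⟨hr.1, hr.2.2⟩⟩⟩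

instance Reg.fimp (φ ψ : Sent P) [Reg φ] [Reg ψ] : Reg (φ ⟹ ψ) :=
  ⟨fun h hp q hq => hp q (hq.trans h), fun h q hq hφ => Reg.dense fun r hr => by
    obtain ⟨s, hs, h'⟩ := h r (hr.trans hq)
    exact ⟨s, hs, h' s le_rfl (Reg.mono (hs.trans hr) hφ)⟩⟩

instance Reg.fnot (φ : Sent P) [Reg φ] : Reg (∼φ) :=
  ⟨fun h hp q hq => hp q (hq.trans h), fun h q hq hφ => by
    obtain ⟨s, hs, h'⟩ := h q hq
    exact h' s le_rfl (Reg.mono hs hφ)⟩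

instance Reg.fiff (φ ψ : Sent P) [Reg φ] [Reg ψ] : Reg (φ ⟺ ψ) :=
  inferInstanceAs (Reg (_ ⋏ _))

instance Reg.fall {I : Sort*} (φ : I → Sent P) [∀ x, Reg (φ x)] : Reg (fall φ) :=
  ⟨fun h hp x => Reg.mono h (hp x), fun h x => Reg.dense fun q hq =>
    (h q hq).imp fun _ hr => ⟨hr.1, hr.2 x⟩⟩

instance Reg.fex {I : Sort*} (φ : I → Sent P) : Reg (fex φ) :=
  ⟨fun h hp q hq => hp q (hq.trans h), fun h q hq => by
    obtain ⟨s, hs, h'⟩ := h q hq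
    obtain ⟨r, hr, h''⟩ := h' s le_rfl
    exact ⟨r, hr.trans hs, h''⟩⟩

theorem fex_intro {I : Sort*} {φ : I → Sent P} {p : P} (x : I) [Reg (φ x)] (h : φ x p) :
    fex φ p := fun q hq => ⟨q, le_rfl, x, Reg.mono hq h⟩

/-- To prove a regular sentence from an existential one, a witness may be assumed. -/
theorem fex_elim {I : Sort*} {φ : I → Sent P} {ψ : Sent P} [Reg ψ] {p : P} (h : fex φ p)
    (h' : ∀ q ≤ p, ∀ x, φ x q → ψ q) : ψ p :=
  Reg.dense fun q hq => by
    obtain ⟨r, hr, x, hx⟩ := h q hq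
    exact ⟨r, hr, h' r (hr.trans hq) x hx⟩

theorem fiff_of {φ ψ : Sent P} {p : P} (h : ∀ q ≤ p, φ q ↔ ψ q) : (φ ⟺ ψ) p :=
  ⟨fun q hq => (h q hq).1, fun q hq => (h q hq).2⟩

theorem fiff_iff {φ ψ : Sent P} {p q : P} (h : (φ ⟺ ψ) p) (hq : q ≤ p) : φ q ↔ ψ q :=
  ⟨h.1 q hq, h.2 q hq⟩

/-- Finitely many existential sentences have simultaneous witnesses. -/
theorem fex_finset_choice {ι X : Type*} [Nonempty X] {φ : ι → X → Sent P}
    (hφ : ∀ i x p q, q ≤ p → φ i x p → φ i x q) {p : P} (s : Finset ι)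
    (h : ∀ i ∈ s, fex (φ i) p) :
    fex (fun f : ι → X => fall fun i => fall fun _ : i ∈ s => φ i (f i)) p := by
  classical
  induction s using Finset.induction_on with
  | empty =>
    exact fun q hq => ⟨q, le_rfl, fun _ => Classical.arbitrary X, fun i hi => by simp at hi⟩
  | insert a s ha ih =>
    intro q hq
    obtain ⟨r, hr, f, hf⟩ := ih (fun i hi => h i (Finset.mem_insert_of_mem hi)) q hq
    obtain ⟨t, ht, x, hx⟩ := h a (Finset.mem_insert_self a s) r (hr.trans hq)
    refine ⟨t, ht.trans hr, Function.update f a x, fun i hi => ?_⟩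
    by_cases hia : i = a
    · subst hia; simpa using hx
    · rw [Function.update_of_ne hia]
      exact hφ _ _ _ _ ht (hf i ((Finset.mem_insert.1 hi).resolve_left hia))

theorem fex_choice {ι X : Type*} [Finite ι] [Nonempty X] {φ : ι → X → Sent P}
    (hφ : ∀ i x p q, q ≤ p → φ i x p → φ i x q) {p : P} (h : ∀ i, fex (φ i) p) :
    fex (fun f : ι → X => fall fun i => φ i (f i)) p := by
  have := Fintype.ofFinite ι
  intro q hq
  obtain ⟨r, hr, f, hf⟩ := fex_finset_choice hφ Finset.univ (fun i _ => h i) q hq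
  exact ⟨r, hr, f, fun i => hf i (Finset.mem_univ i)⟩

/-! ### Equality and membership of names; pairs. -/

theorem feq_refl (σ : PName P) (p : P) : (σ ≐ σ) p := by
  induction σ generalizing p with
  | mk ι x c ih =>
    simp only [feq]
    exact ⟨fun a q _ ha r hr => ⟨r, le_rfl, a, hr.trans ha, ih a r⟩,
      fun a q _ ha r hr => ⟨r, le_rfl, a, hr.trans ha, ih a r⟩⟩

theorem feq_symm {σ τ : PName P} {p : P} (h : (σ ≐ τ) p) : (τ ≐ σ) p := by
  induction σ generalizing τ p with
  | mk ι x c ih =>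
    cases τ with
    | mk κ y d =>
      simp only [feq] at h ⊢
      refine ⟨fun b q hq hb r hr => ?_, fun a q hq ha r hr => ?_⟩
      · obtain ⟨s, hs, a, ha, hab⟩ := h.2 b q hq hb r hr
        exact ⟨s, hs, a, ha, ih a hab⟩
      · obtain ⟨s, hs, b, hb, hab⟩ := h.1 a q hq ha r hr
        exact ⟨s, hs, b, hb, ih a hab⟩

instance Reg.feq (σ τ : PName P) : Reg (σ ≐ τ) := by
  cases σ with
  | mk ι x c =>
    cases τ with
    | mk κ y d =>
      refine ⟨fun hq hp => ?_, fun h => ?_⟩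
      · simp only [Forcing.feq] at hp ⊢
        exact ⟨fun a q hq' => hp.1 a q (hq'.trans hq), fun b q hq' => hp.2 b q (hq'.trans hq)⟩
      · simp only [Forcing.feq] at h ⊢
        refine ⟨fun a q hq ha r hr => ?_, fun b q hq hb r hr => ?_⟩
        · obtain ⟨s, hs, h'⟩ := h r (hr.trans hq)
          obtain ⟨t, ht, h''⟩ := h'.1 a s le_rfl ((hs.trans hr).trans ha) s le_rfl
          exact ⟨t, ht.trans hs, h''⟩
        · obtain ⟨s, hs, h'⟩ := h r (hr.trans hq)
          obtain ⟨t, ht, h''⟩ := h'.2 b s le_rfl ((hs.trans hr).trans hb) s le_rfl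
          exact ⟨t, ht.trans hs, h''⟩

instance Reg.fmem (σ τ : PName P) : Reg (σ ∊ τ) := by
  cases τ with
  | mk κ y d =>
    refine ⟨fun hq hp => ?_, fun h => ?_⟩
    · simp only [Forcing.fmem] at hp ⊢
      exact fun q hq' => hp q (hq'.trans hq)
    · simp only [Forcing.fmem] at h ⊢
      intro q hq
      obtain ⟨s, hs, h'⟩ := h q hq
      obtain ⟨t, ht, h''⟩ := h' s le_rfl
      exact ⟨t, ht.trans hs, h''⟩

theorem feq_trans {σ τ ρ : PName P} {p : P} (h : (σ ≐ τ) p) (h' : (τ ≐ ρ) p) : (σ ≐ ρ) p := by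
  induction σ generalizing τ ρ p with
  | mk ι x c ih =>
    cases τ with
    | mk κ y d =>
      cases ρ with
      | mk μ z e =>
        simp only [feq] at h h' ⊢
        refine ⟨fun a q hq ha r hr => ?_, fun b q hq hb r hr => ?_⟩
        · obtain ⟨s, hs, b, hb, hab⟩ := h.1 a q hq ha r hr
          obtain ⟨t, ht, b', hb', hbb⟩ := h'.1 b s (hs.trans (hr.trans hq)) hb s le_rfl
          exact ⟨t, ht.trans hs, b', hb', ih a (Reg.mono ht hab) hbb⟩
        · obtain ⟨s, hs, b', hb', hab⟩ := h'.2 b q hq hb r hr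
          obtain ⟨t, ht, a, ha, hbb⟩ := h.2 b' s (hs.trans (hr.trans hq)) hb' s le_rfl
          exact ⟨t, ht.trans hs, a, ha, ih a hbb (Reg.mono ht hab)⟩

theorem fmem_mk_intro {σ : PName P} {ι : Type u} {y : ι → PName P} {d : ι → P} {p : P} (b : ι)
    (hb : p ≤ d b) (h : (σ ≐ y b) p) : (σ ∊ PName.mk ι y d) p := by
  simp only [fmem]
  exact fun q hq => ⟨q, le_rfl, b, hq.trans hb, Reg.mono hq h⟩

theorem fmem_mk_elim {σ : PName P} {ι : Type u} {y : ι → PName P} {d : ι → P} {ψ : Sent P} [Reg ψ]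
    {p : P} (h : (σ ∊ PName.mk ι y d) p) (h' : ∀ q ≤ p, ∀ b, q ≤ d b → (σ ≐ y b) q → ψ q) :
    ψ p := by
  simp only [fmem] at h
  refine Reg.dense fun q hq => ?_
  obtain ⟨r, hr, b, hb, hx⟩ := h q hq
  exact ⟨r, hr, h' r (hr.trans hq) b hb hx⟩

theorem fmem_congr_left {σ σ' τ : PName P} {p : P} (h : (σ ≐ σ') p) (h' : (σ ∊ τ) p) :
    (σ' ∊ τ) p := by
  cases τ with
  | mk κ y d =>
    exact fmem_mk_elim h' fun q hq b hb hx =>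
      fmem_mk_intro b hb (feq_trans (feq_symm (Reg.mono hq h)) hx)

theorem fmem_congr_right {σ τ τ' : PName P} {p : P} (h : (τ ≐ τ') p) (h' : (σ ∊ τ) p) :
    (σ ∊ τ') p := by
  cases τ with
  | mk κ y d =>
    refine fmem_mk_elim h' fun q hq b hb hx => ?_
    cases τ' with
    | mk μ z e =>
      simp only [feq] at h
      simp only [fmem]
      intro r hr
      obtain ⟨s, hs, c, hc, hbc⟩ := h.1 b q hq hb r hr
      exact ⟨s, hs, c, hc, feq_trans (Reg.mono (hs.trans hr) hx) hbc⟩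

theorem feq_of_ext {σ τ : PName P} {p : P}
    (h : ∀ q ≤ p, ∀ z : PName P, (z ∊ σ) q ↔ (z ∊ τ) q) : (σ ≐ τ) p := by
  cases σ with
  | mk ι x c =>
    cases τ with
    | mk κ y d =>
      simp only [feq]
      refine ⟨fun a q hq ha r hr => ?_, fun b q hq hb r hr => ?_⟩
      · have := (h q hq (x a)).1 (fmem_mk_intro a ha (feq_refl _ _))
        simp only [fmem] at this
        exact this r hr
      · have := (h q hq (y b)).2 (fmem_mk_intro b hb (feq_refl _ _))
        simp only [fmem] at this
        obtain ⟨s, hs, a, ha, hab⟩ := this r hr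
        exact ⟨s, hs, a, ha, feq_symm hab⟩

theorem fmem_congr {σ σ' τ τ' : PName P} {p : P} (h : (σ ≐ σ') p) (h' : (τ ≐ τ') p) :
    (σ ∊ τ) p ↔ (σ' ∊ τ') p :=
  ⟨fun H => fmem_congr_left h (fmem_congr_right h' H),
    fun H => fmem_congr_left (feq_symm h) (fmem_congr_right (feq_symm h') H)⟩

theorem fmem_upair_left (a b : PName P) (p : P) : (a ∊ upair a b) p :=
  fmem_mk_intro (ULift.up true, p) le_rfl (by simpa using feq_refl a p)

theorem fmem_upair_right (a b : PName P) (p : P) : (b ∊ upair a b) p :=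
  fmem_mk_intro (ULift.up false, p) le_rfl (by simpa using feq_refl b p)

theorem fmem_upair_elim {z a b : PName P} {ψ : Sent P} [Reg ψ] {p : P} (h : (z ∊ upair a b) p)
    (ha : ∀ q ≤ p, (z ≐ a) q → ψ q) (hb : ∀ q ≤ p, (z ≐ b) q → ψ q) : ψ p := by
  refine fmem_mk_elim h fun q hq i _ hx => ?_
  obtain ⟨⟨i⟩, r⟩ := i
  cases i
  · exact hb q hq (by simpa using hx)
  · exact ha q hq (by simpa using hx)

theorem fmem_singleton {z a : PName P} {p : P} (h : (z ∊ upair a a) p) : (z ≐ a) p :=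
  fmem_upair_elim h (fun _ _ h => h) fun _ _ h => h

theorem upair_congr {a b a' b' : PName P} {p : P} (ha : (a ≐ a') p) (hb : (b ≐ b') p) :
    (upair a b ≐ upair a' b') p :=
  feq_of_ext fun _ hq _ =>
    ⟨fun h => fmem_upair_elim h
      (fun _ hr h => fmem_congr_left (feq_symm (feq_trans h (Reg.mono (hr.trans hq) ha)))
        (fmem_upair_left _ _ _))
      (fun _ hr h => fmem_congr_left (feq_symm (feq_trans h (Reg.mono (hr.trans hq) hb)))
        (fmem_upair_right _ _ _)),
    fun h => fmem_upair_elim h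
      (fun _ hr h => fmem_congr_left (feq_trans (Reg.mono (hr.trans hq) ha) (feq_symm h))
        (fmem_upair_left _ _ _))
      (fun _ hr h => fmem_congr_left (feq_trans (Reg.mono (hr.trans hq) hb) (feq_symm h))
        (fmem_upair_right _ _ _))⟩

theorem opair_congr {a b a' b' : PName P} {p : P} (ha : (a ≐ a') p) (hb : (b ≐ b') p) :
    (opair a b ≐ opair a' b') p :=
  upair_congr (upair_congr ha ha) (upair_congr ha hb)

theorem opair_inj {a b c d : PName P} {p : P} (h : (opair a b ≐ opair c d) p) :
    (a ≐ c) p ∧ (b ≐ d) p := by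
  have hac : (a ≐ c) p := by
    refine fmem_upair_elim (fmem_congr_right h (fmem_upair_left (upair a a) (upair a b) p))
      (fun q _ hx => ?_) (fun q _ hx => ?_)
    · exact fmem_singleton (fmem_congr_right hx (fmem_upair_left a a q))
    · exact feq_symm (fmem_singleton (fmem_congr_right (feq_symm hx) (fmem_upair_left c d q)))
  refine ⟨hac, ?_⟩
  -- The degenerate case: if `b = c = a`, the pair collapses to `{{a}}`, which forces `d = a` as
  -- well.
  have key : ∀ q ≤ p, (b ≐ c) q → (b ≐ d) q := fun q hq hbc => by
    have hda : (d ∊ upair a b) q → (b ≐ d) q := fun hd => fmem_upair_elim hd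
      (fun r hr hx => feq_trans (Reg.mono hr hbc)
        (feq_symm (feq_trans hx (Reg.mono (hr.trans hq) hac)))) fun r _ hx => feq_symm hx
    refine fmem_upair_elim (fmem_congr_right (feq_symm (Reg.mono hq h))
      (fmem_upair_right (upair c c) (upair c d) q)) (fun r hr hx => ?_) (fun r hr hx => ?_)
    · have := fmem_singleton (fmem_congr_right hx (fmem_upair_right c d r))
      exact feq_trans (Reg.mono hr hbc)
        (feq_symm (feq_trans this (Reg.mono (hr.trans hq) hac)))
    · refine fmem_upair_elim (fmem_congr_right hx (fmem_upair_right c d r))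
        (fun s hs hx => ?_) (fun s _ hx => feq_symm hx)
      exact feq_trans (Reg.mono (hs.trans hr) hbc)
        (feq_symm (feq_trans hx (Reg.mono ((hs.trans hr).trans hq) hac)))
  refine fmem_upair_elim (fmem_congr_right h (fmem_upair_right (upair a a) (upair a b) p))
    (fun q hq hx => ?_) (fun q hq hx => ?_)
  · exact key q hq (fmem_singleton (fmem_congr_right hx (fmem_upair_right a b q)))
  · exact fmem_upair_elim (fmem_congr_right hx (fmem_upair_right a b q))
      (fun r hr hx => key r (hr.trans hq) hx) fun r _ hx => hx

/-! ### Canonical names of ordinals. -/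

theorem fmem_ordName_intro {α β : Ordinal.{u}} (h : β < α) (p : P) :
    (ordName β ∊ (ordName α : PName P)) p := by
  rw [ordName.eq_1 α]
  refine fmem_mk_intro (equivShrink (Set.Iio α) ⟨β, h⟩, p) le_rfl ?_
  simpa using feq_refl (ordName β) p

theorem fmem_ordName_elim {z : PName P} {α : Ordinal.{u}} {ψ : Sent P} [Reg ψ] {p : P}
    (h : (z ∊ ordName α) p) (h' : ∀ q ≤ p, ∀ β < α, (z ≐ ordName β) q → ψ q) : ψ p := by
  rw [ordName.eq_1 α] at h
  exact fmem_mk_elim h fun q hq b _ hx => h' q hq _ ((equivShrink (Set.Iio α)).symm b.1).2 hx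

theorem not_fmem_ordName_self (α : Ordinal.{u}) (p : P) :
    ¬ (ordName α ∊ (ordName α : PName P)) p := by
  induction α using WellFoundedLT.induction generalizing p with
  | ind α ih =>
    intro h
    refine fmem_ordName_elim (ψ := fun _ => False) h fun q hq β hβ hx => ?_
    exact ih β hβ q (fmem_congr_right hx (fmem_ordName_intro hβ q))

theorem ordName_inj {α β : Ordinal.{u}} {p : P} (h : (ordName α ≐ (ordName β : PName P)) p) :
    α = β := by
  rcases lt_trichotomy α β with hlt | heq | hlt
  · exact (not_fmem_ordName_self α p
      (fmem_congr_right (feq_symm h) (fmem_ordName_intro hlt p))).elim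
  · exact heq
  · exact (not_fmem_ordName_self β p (fmem_congr_right h (fmem_ordName_intro hlt p))).elim

theorem fmem_ordName_iff {α β : Ordinal.{u}} {p : P} :
    (ordName β ∊ (ordName α : PName P)) p ↔ β < α := by
  refine ⟨fun h => ?_, fun h => fmem_ordName_intro h p⟩
  exact fmem_ordName_elim (ψ := fun _ => β < α) h fun q _ γ hγ hx => (ordName_inj hx).symm ▸ hγ

theorem fmem_omega0_elim {z : PName P} {ψ : Sent P} [Reg ψ] {p : P}
    (h : (z ∊ ordName Ordinal.omega0) p)
    (h' : ∀ q ≤ p, ∀ n : ℕ, (z ≐ ordName (n : Ordinal)) q → ψ q) : ψ p := by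
  refine fmem_ordName_elim h fun q hq β hβ hx => ?_
  obtain ⟨n, rfl⟩ := Ordinal.lt_omega0.1 hβ
  exact h' q hq n hx

theorem isTrans_ordName (α : Ordinal.{u}) (p : P) : IsTrans (ordName α) p := by
  intro x q hq hx z r hr hz
  refine fmem_ordName_elim (Reg.mono hr hx) fun s hs β hβ hxβ => ?_
  refine fmem_ordName_elim (fmem_congr_right hxβ (Reg.mono hs hz)) fun t _ γ hγ hzγ => ?_
  exact fmem_congr_left (feq_symm hzγ) (fmem_ordName_intro (hγ.trans hβ) t)

/-! ### Regularity of the formulas and their invariance under forced equality. -/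

instance Reg.fsub (x y : PName P) : Reg (fsub x y) := by unfold Forcing.fsub; infer_instance

instance Reg.isRangeOf {n : ℕ} (x : PName P) (t : Fin n → PName P) : Reg (IsRangeOf x t) := by
  unfold IsRangeOf; infer_instance

instance Reg.isFin (x : PName P) : Reg (IsFin x) := by unfold IsFin; infer_instance

instance Reg.hasCard (n : ℕ) (x : PName P) : Reg (HasCard n x) := by unfold HasCard; infer_instance

instance Reg.isUnionOf {n : ℕ} (s : PName P) (w : Fin n → PName P) : Reg (IsUnionOf s w) := by
  unfold IsUnionOf; infer_instance

instance Reg.isTrans (x : PName P) : Reg (IsTrans x) := by unfold IsTrans; infer_instance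

instance Reg.isFunOn (f x : PName P) : Reg (IsFunOn f x) := by unfold IsFunOn; infer_instance

instance Reg.mapsInto (f x : PName P) : Reg (MapsInto f x) := by unfold MapsInto; infer_instance

instance Reg.isCountable (x : PName P) : Reg (IsCountable x) := by
  unfold IsCountable; infer_instance

instance Reg.isSelection (W Q v : PName P) : Reg (IsSelection W Q v) := by
  unfold IsSelection; infer_instance

instance Reg.isDisjointSeq (W u : PName P) : Reg (IsDisjointSeq W u) := by
  unfold IsDisjointSeq; infer_instance

theorem fsub_congr {x x' y y' : PName P} {p : P} (hx : (x ≐ x') p) (hy : (y ≐ y') p)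
    (h : fsub x y p) : fsub x' y' p := fun z q hq hz =>
  fmem_congr_right (Reg.mono hq hy) (h z q hq (fmem_congr_right (feq_symm (Reg.mono hq hx)) hz))

theorem isRangeOf_congr {n : ℕ} {x y : PName P} {t : Fin n → PName P} {p : P} (hx : (x ≐ y) p)
    (h : IsRangeOf x t p) : IsRangeOf y t p := fun z => fiff_of fun q hq =>
  (fmem_congr (feq_refl z q) (feq_symm (Reg.mono hq hx))).trans (fiff_iff (h z) hq)

theorem isFin_congr {x y : PName P} {p : P} (hx : (x ≐ y) p) (h : IsFin x p) : IsFin y p :=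
  fex_elim h fun _ hq n h => fex_elim h fun _ hr t h =>
    fex_intro n (fex_intro t (isRangeOf_congr (Reg.mono (hr.trans hq) hx) h))

theorem hasCard_congr {n : ℕ} {x y : PName P} {p : P} (hx : (x ≐ y) p) (h : HasCard n x p) :
    HasCard n y p :=
  fex_elim h fun _ hq t h => fex_intro t ⟨h.1, isRangeOf_congr (Reg.mono hq hx) h.2⟩

theorem isTrans_congr {x y : PName P} {p : P} (hx : (x ≐ y) p) (h : IsTrans x p) :
    IsTrans y p := fun z q hq hz =>
  fsub_congr (feq_refl z q) (Reg.mono hq hx)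
    (h z q hq (fmem_congr_right (feq_symm (Reg.mono hq hx)) hz))

theorem isFunOn_congr {f x y : PName P} {p : P} (hx : (x ≐ y) p) (h : IsFunOn f x p) :
    IsFunOn f y p := by
  refine ⟨fun z q hq hz => ?_, fun a q hq ha => ?_, h.2.2⟩
  · refine fex_elim (h.1 z q hq hz) fun r hr a h => fex_elim h fun s hs b h => ?_
    exact fex_intro a (fex_intro b
      ⟨fmem_congr_right (Reg.mono (hs.trans (hr.trans hq)) hx) h.1, h.2⟩)
  · exact h.2.1 a q hq (fmem_congr_right (feq_symm (Reg.mono hq hx)) ha)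

theorem isCountable_congr {x y : PName P} {p : P} (hx : (x ≐ y) p) (h : IsCountable x p) :
    IsCountable y p :=
  fex_elim h fun _ hq f h => fex_intro f ⟨isFunOn_congr (Reg.mono hq hx) h.1, h.2⟩

end Regular
end Forcing

/-! ### The poset of finite approximations. -/

namespace Forcing

/-- A finite approximation to a family `fam` of `(k+1)`-element sets and to a colouring `lnk` of
finite sets such that no `k` sets of the same colour cover a member of the family. -/
@[ext]
structure Cond (k : ℕ) (Λ : Type u) where
  dom : Finset Λ
  fam : Finset (Finset Λ)
  lnk : Finset (Finset Λ × ℕ)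
  fam_sub : ∀ a ∈ fam, a ⊆ dom
  fam_card : ∀ a ∈ fam, a.card = k + 1
  lnk_sub : ∀ v n, (v, n) ∈ lnk → v ⊆ dom
  lnk_fun : ∀ v m n, (v, m) ∈ lnk → (v, n) ∈ lnk → m = n
  lnk_free : ∀ (w : Fin k → Finset Λ) n, (∀ i, (w i, n) ∈ lnk) → ∀ a ∈ fam, ∃ x ∈ a, ∀ i, x ∉ w i

namespace Cond

variable {k : ℕ} {Λ : Type u}

/-- The last clause is conservativity: membership in the family is settled for all subsets of the
domain. It is what makes `Free` persist to extensions. -/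
instance : PartialOrder (Cond k Λ) where
  le q p := p.dom ⊆ q.dom ∧ p.fam ⊆ q.fam ∧ p.lnk ⊆ q.lnk ∧ ∀ a ∈ q.fam, a ⊆ p.dom → a ∈ p.fam
  le_refl p := ⟨subset_rfl, subset_rfl, subset_rfl, fun _ h _ => h⟩
  le_trans p q r hpq hqr := ⟨hqr.1.trans hpq.1, hqr.2.1.trans hpq.2.1, hqr.2.2.1.trans hpq.2.2.1,
    fun a ha h => hqr.2.2.2 a (hpq.2.2.2 a ha (h.trans hqr.1)) h⟩
  le_antisymm p q hpq hqp := Cond.ext (hqp.1.antisymm hpq.1) (hqp.2.1.antisymm hpq.2.1)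
    (hqp.2.2.1.antisymm hpq.2.2.1)

theorem dom_mono {p q : Cond k Λ} (h : q ≤ p) : p.dom ⊆ q.dom := h.1

theorem fam_mono {p q : Cond k Λ} (h : q ≤ p) : p.fam ⊆ q.fam := h.2.1

theorem lnk_mono {p q : Cond k Λ} (h : q ≤ p) : p.lnk ⊆ q.lnk := h.2.2.1

theorem fam_conservative {p q : Cond k Λ} (h : q ≤ p) {a : Finset Λ} (ha : a ∈ q.fam)
    (hp : a ⊆ p.dom) : a ∈ p.fam := h.2.2.2 a ha hp

/-- `v` is a set decided by `p` to be free. -/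
def Free (p : Cond k Λ) (v : Finset Λ) : Prop := v ⊆ p.dom ∧ ∀ a ∈ p.fam, ¬ a ⊆ v

theorem Free.mono {p q : Cond k Λ} (h : q ≤ p) {v : Finset Λ} (hv : p.Free v) : q.Free v :=
  ⟨hv.1.trans (dom_mono h), fun a ha hav => hv.2 a (fam_conservative h ha (hav.trans hv.1)) hav⟩

/-- Apply `lnk_free` to `k` copies of `v`; at least one copy is needed. -/
theorem free_of_mem_lnk (hk : k ≠ 0) {p : Cond k Λ} {v : Finset Λ} {n : ℕ} (h : (v, n) ∈ p.lnk) :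
    p.Free v :=
  ⟨p.lnk_sub v n h, fun a ha hav => by
    obtain ⟨x, hx, hxv⟩ := p.lnk_free (fun _ => v) n (fun _ => h) a ha
    exact hxv ⟨0, Nat.pos_of_ne_zero hk⟩ (hav hx)⟩

/-- The condition with domain `s` and nothing else. -/
def ofFinset (k : ℕ) (s : Finset Λ) : Cond k Λ where
  dom := s
  fam := ∅
  lnk := ∅
  fam_sub := by simp
  fam_card := by simp
  lnk_sub := by simp
  lnk_fun := by simp
  lnk_free := by simp

theorem image_injOn {κ : Type*} [DecidableEq κ] {f : Λ → κ} {s v w : Finset Λ}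
    (hf : Set.InjOn f s) (hv : v ⊆ s) (hw : w ⊆ s) (h : v.image f = w.image f) : v = w := by
  apply Finset.coe_injective
  refine (hf.image_eq_image_iff (Finset.coe_subset.2 hv) (Finset.coe_subset.2 hw)).1 ?_
  simpa using congrArg (fun s : Finset κ => (s : Set κ)) h

variable [DecidableEq Λ]

/-- Enlarge the domain of a condition. -/
def extend (p : Cond k Λ) (s : Finset Λ) : Cond k Λ :=
  { p with
    dom := p.dom ∪ s
    fam_sub := fun a ha => (p.fam_sub a ha).trans Finset.subset_union_left
    lnk_sub := fun v n h => (p.lnk_sub v n h).trans Finset.subset_union_left }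

theorem extend_le (p : Cond k Λ) (s : Finset Λ) : p.extend s ≤ p :=
  ⟨Finset.subset_union_left, subset_rfl, subset_rfl, fun _ h _ => h⟩

/-- A fresh colour is given to `v`. It has no other set in its class, so `lnk_free` for it only says
that `v` is free. -/
theorem exists_le_lnk (p : Cond k Λ) {v : Finset Λ} (hv : p.Free v) :
    ∃ q ≤ p, ∃ n, (v, n) ∈ q.lnk := by
  by_cases h : ∃ n, (v, n) ∈ p.lnk
  · exact ⟨p, le_rfl, h⟩
  push Not at h
  obtain ⟨N, hN⟩ := Infinite.exists_notMem_finset (p.lnk.image Prod.snd)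
  have hN : ∀ w, (w, N) ∉ p.lnk := fun w hw => hN (Finset.mem_image_of_mem Prod.snd hw)
  refine ⟨{ p with
    lnk := insert (v, N) p.lnk
    lnk_sub := ?_
    lnk_fun := ?_
    lnk_free := ?_ }, ⟨subset_rfl, subset_rfl, Finset.subset_insert _ _, fun _ h _ => h⟩,
    N, Finset.mem_insert_self _ _⟩
  · intro w n hw
    rcases Finset.mem_insert.1 hw with hw | hw
    · rw [(Prod.mk.inj hw).1]; exact hv.1
    · exact p.lnk_sub w n hw
  · intro w m n hm hn
    simp only [Finset.mem_insert, Prod.mk.injEq] at hm hn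
    rcases hm with ⟨rfl, rfl⟩ | hm <;> rcases hn with ⟨h1, rfl⟩ | hn
    · rfl
    · exact (h n hn).elim
    · exact (h m (h1 ▸ hm)).elim
    · exact p.lnk_fun w m n hm hn
  · intro w n hw a ha
    simp only [Finset.mem_insert, Prod.mk.injEq] at hw
    by_cases hn : n = N
    · subst hn
      have hw : ∀ i, w i = v := fun i => by
        rcases hw i with h | h
        · exact h.1
        · exact (hN _ h).elim
      obtain ⟨x, hx, hxv⟩ := Finset.not_subset.1 (hv.2 a ha)
      exact ⟨x, hx, fun i => by rwa [hw i]⟩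
    · exact p.lnk_free w n (fun i => (hw i).resolve_left fun h => hn h.2) a ha

/-! ### Countably many codes and amalgamation. -/

section Code

variable (r : Λ → Set ℕ)

open Classical in
/-- The first `m` digits of the real attached to a point. -/
noncomputable def digits (m : ℕ) (x : Λ) : Finset ℕ := {n ∈ Finset.range m | n ∈ r x}

theorem exists_injOn_digits (hr : Function.Injective r) (s : Finset Λ) :
    ∃ m, Set.InjOn (digits r m) s := by
  have hsep : ∀ x y : Λ, ∃ m, x ≠ y → digits r m x ≠ digits r m y := fun x y => by
    by_cases hxy : x = y
    · exact ⟨0, fun h => (h hxy).elim⟩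
    · obtain ⟨n, hn⟩ : ∃ n, ¬ (n ∈ r x ↔ n ∈ r y) := by
        by_contra! h
        exact hxy (hr (Set.ext h))
      refine ⟨n + 1, fun _ h => hn ?_⟩
      simpa [digits] using Finset.ext_iff.1 h n
  have hmono : ∀ {m m'} {x y : Λ}, m ≤ m' → digits r m' x = digits r m' y →
      digits r m x = digits r m y := fun {m m' x y} hm h => by
    ext n
    have := Finset.ext_iff.1 h n
    simp only [digits, Finset.mem_filter, Finset.mem_range] at this ⊢
    constructor <;> rintro ⟨h1, h2⟩
    · exact ⟨h1, (this.1 ⟨h1.trans_le hm, h2⟩).2⟩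
    · exact ⟨h1, (this.2 ⟨h1.trans_le hm, h2⟩).2⟩
  choose f hf using hsep
  -- Longer digit strings determine shorter ones, so the largest of the finitely many separating
  -- lengths works for all pairs.
  refine ⟨(s ×ˢ s).sup fun z => f z.1 z.2, fun x hx y hy h => ?_⟩
  by_contra hxy
  refine hf x y hxy (hmono ?_ h)
  exact Finset.le_sup (f := fun z : Λ × Λ => f z.1 z.2) (b := (x, y))
    (Finset.mk_mem_product hx hy)

/-- The isomorphism type of a condition over the countable set of finite digit sequences. -/
noncomputable def shape (m : ℕ) (p : Cond k Λ) :
    Finset (Finset (Finset ℕ)) × Finset (Finset (Finset ℕ) × ℕ) :=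
  (p.fam.image fun a => a.image (digits r m),
    p.lnk.image fun x => (x.1.image (digits r m), x.2))

/-- Finitely many conditions of the same shape have a common lower bound, and new sets can be added
to the family if no `k` sets, each below one of the given domains, cover them. -/
theorem exists_amalgam {ι : Type*} (s : Finset ι) (p : ι → Cond k Λ) (hk : k ≠ 0) (m : ℕ)
    (hinj : ∀ i ∈ s, Set.InjOn (digits r m) (p i).dom)
    (hshape : ∀ i ∈ s, ∀ j ∈ s, (p i).shape r m = (p j).shape r m)
    (N : Finset (Finset Λ)) (hN : ∀ a ∈ N, a.card = k + 1)
    (hNsub : ∀ a ∈ N, a ⊆ s.biUnion fun i => (p i).dom)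
    (hNfree : ∀ a ∈ N, ∀ w : Fin k → Finset Λ, (∀ j, ∃ i ∈ s, w j ⊆ (p i).dom) →
      ∃ x ∈ a, ∀ j, x ∉ w j) :
    ∃ q : Cond k Λ, (∀ i ∈ s, q ≤ p i) ∧ N ⊆ q.fam := by
  -- Equal shapes let members of the family, and below coloured sets, be copied from one condition
  -- to another with the same digits. A copy of a set already inside the target domain is that set
  -- itself, by injectivity of the digits there.
  have hA : ∀ i ∈ s, ∀ j ∈ s, ∀ a ∈ (p j).fam, ∃ b ∈ (p i).fam,
      b.image (digits r m) = a.image (digits r m) := fun i hi j hj a ha => by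
    have : a.image (digits r m) ∈ ((p i).shape r m).1 := by
      rw [hshape i hi j hj]
      exact Finset.mem_image_of_mem (fun a => a.image (digits r m)) ha
    exact Finset.mem_image.1 this
  have hH : ∀ i ∈ s, ∀ j ∈ s, ∀ v n, (v, n) ∈ (p j).lnk → ∃ w, (w, n) ∈ (p i).lnk ∧
      w.image (digits r m) = v.image (digits r m) := fun i hi j hj v n hv => by
    have : (v.image (digits r m), n) ∈ ((p i).shape r m).2 := by
      rw [hshape i hi j hj]
      exact Finset.mem_image_of_mem (fun x : Finset Λ × ℕ => (x.1.image (digits r m), x.2)) hv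
    obtain ⟨⟨w, n'⟩, hw, h⟩ := Finset.mem_image.1 this
    obtain ⟨h1, rfl⟩ := Prod.mk.inj h
    exact ⟨w, hw, h1⟩
  refine ⟨{
    dom := s.biUnion fun i => (p i).dom
    fam := (s.biUnion fun i => (p i).fam) ∪ N
    lnk := s.biUnion fun i => (p i).lnk
    fam_sub := ?_
    fam_card := ?_
    lnk_sub := ?_
    lnk_fun := ?_
    lnk_free := ?_ }, fun i hi => ⟨?_, ?_, ?_, ?_⟩, Finset.subset_union_right⟩
  · intro a ha
    rcases Finset.mem_union.1 ha with ha | ha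
    · obtain ⟨i, hi, ha⟩ := Finset.mem_biUnion.1 ha
      exact ((p i).fam_sub a ha).trans (Finset.subset_biUnion_of_mem (fun i => (p i).dom) hi)
    · exact hNsub a ha
  · intro a ha
    rcases Finset.mem_union.1 ha with ha | ha
    · obtain ⟨i, hi, ha⟩ := Finset.mem_biUnion.1 ha
      exact (p i).fam_card a ha
    · exact hN a ha
  · intro v n hv
    obtain ⟨i, hi, hv⟩ := Finset.mem_biUnion.1 hv
    exact ((p i).lnk_sub v n hv).trans (Finset.subset_biUnion_of_mem (fun i => (p i).dom) hi)
  · intro v n n' hn hn'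
    obtain ⟨i, hi, hn⟩ := Finset.mem_biUnion.1 hn
    obtain ⟨j, hj, hn'⟩ := Finset.mem_biUnion.1 hn'
    obtain ⟨w, hw, hwv⟩ := hH i hi j hj v n' hn'
    have : w = v := image_injOn (hinj i hi) ((p i).lnk_sub _ _ hw) ((p i).lnk_sub _ _ hn) hwv
    exact (p i).lnk_fun v n n' hn (this ▸ hw)
  · intro w n hw a ha
    have hw : ∀ j, ∃ i ∈ s, (w j, n) ∈ (p i).lnk := fun j => by simpa using hw j
    rcases Finset.mem_union.1 ha with ha | ha
    · obtain ⟨i, hi, ha⟩ := Finset.mem_biUnion.1 ha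
      -- All `w j` are copied into the condition that owns `a`. A point of `a` outside the copies is
      -- outside the `w j` too, as its digits would otherwise occur in a copy.
      have : ∀ j, ∃ v, (v, n) ∈ (p i).lnk ∧ v.image (digits r m) = (w j).image (digits r m) :=
        fun j => by
          obtain ⟨i', hi', hj⟩ := hw j
          exact hH i hi i' hi' _ _ hj
      choose v hv hvw using this
      obtain ⟨x, hx, hxv⟩ := (p i).lnk_free v n hv a ha
      refine ⟨x, hx, fun j hxj => ?_⟩
      have : digits r m x ∈ (v j).image (digits r m) := by
        rw [hvw j]; exact Finset.mem_image_of_mem _ hxj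
      obtain ⟨y, hy, hyx⟩ := Finset.mem_image.1 this
      have := hinj i hi ((p i).lnk_sub _ _ (hv j) hy) ((p i).fam_sub a ha hx) hyx
      exact hxv j (this ▸ hy)
    · exact hNfree a ha w fun j => (hw j).imp fun i h => ⟨h.1, (p i).lnk_sub _ _ h.2⟩
  · exact Finset.subset_biUnion_of_mem (fun i => (p i).dom) hi
  · exact (Finset.subset_biUnion_of_mem (fun i => (p i).fam) hi).trans Finset.subset_union_left
  · exact Finset.subset_biUnion_of_mem (fun i => (p i).lnk) hi
  · intro a ha hai
    rcases Finset.mem_union.1 ha with ha | ha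
    · obtain ⟨j, hj, ha⟩ := Finset.mem_biUnion.1 ha
      obtain ⟨b, hb, hba⟩ := hA i hi j hj a ha
      have : b = a := image_injOn (hinj i hi) ((p i).fam_sub _ hb) hai hba
      exact this ▸ hb
    -- Conservativity for a new set: `k ≥ 1` copies of one domain do not cover it, so it lies in no
    -- single old domain.
    · obtain ⟨x, hx, hx'⟩ := hNfree a ha (fun _ => (p i).dom) fun _ => ⟨i, hi, subset_rfl⟩
      exact (hx' ⟨0, Nat.pos_of_ne_zero hk⟩ (hai hx)).elim

/-- The poset is `σ`-centred, in a strong form. -/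
theorem exists_code (hr : Function.Injective r) (hk : k ≠ 0) :
    ∃ (T : Type) (_ : Countable T) (c : Cond k Λ → T), ∀ {ι : Type u} (s : Finset ι)
      (p : ι → Cond k Λ), (∀ i ∈ s, ∀ j ∈ s, c (p i) = c (p j)) →
      ∀ (N : Finset (Finset Λ)), (∀ a ∈ N, a.card = k + 1) →
        (∀ a ∈ N, a ⊆ s.biUnion fun i => (p i).dom) →
        (∀ a ∈ N, ∀ w : Fin k → Finset Λ, (∀ j, ∃ i ∈ s, w j ⊆ (p i).dom) →
          ∃ x ∈ a, ∀ j, x ∉ w j) →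
        ∃ q : Cond k Λ, (∀ i ∈ s, q ≤ p i) ∧ N ⊆ q.fam := by
  choose m hm using fun p : Cond k Λ => exists_injOn_digits r hr p.dom
  -- The digit length is part of the code, so conditions with equal codes are separated at the same
  -- length.
  refine ⟨ℕ × (Finset (Finset (Finset ℕ)) × Finset (Finset (Finset ℕ) × ℕ)), inferInstance,
    fun p => (m p, p.shape r (m p)), fun {ι} s p h N hN hNs hNf => ?_⟩
  rcases s.eq_empty_or_nonempty with rfl | ⟨i₀, hi₀⟩
  · have : N = ∅ := Finset.eq_empty_of_forall_notMem fun a ha => by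
      have h1 := hN a ha
      have h2 := Finset.card_le_card (hNs a ha)
      simp at h2
      simp [h2] at h1
    exact ⟨ofFinset k ∅, by simp, by simp [this]⟩
  · have hme : ∀ i ∈ s, m (p i) = m (p i₀) := fun i hi => (Prod.mk.inj (h i hi i₀ hi₀)).1
    refine exists_amalgam r s p hk (m (p i₀)) (fun i hi => hme i hi ▸ hm (p i))
      (fun i hi j hj => ?_) N hN hNs hNf
    have := (Prod.mk.inj (h i hi j hj)).2
    rwa [hme i hi, hme j hj] at this

end Code

end Cond

end Forcing

/-! ### The ordinal `ω₁`, and the cardinality and precalibre of the poset. -/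

namespace Forcing

/-- The first uncountable ordinal as a type. -/
abbrev OmegaOne : Type u := (Ordinal.omega.{u} 1).ToType

namespace OmegaOne

/-- The ordinal given by an element of `OmegaOne`. -/
noncomputable def ord (x : OmegaOne.{u}) : Ordinal.{u} := (Ordinal.ToType.mk.symm x).1

theorem ord_lt (x : OmegaOne.{u}) : x.ord < Ordinal.omega 1 := (Ordinal.ToType.mk.symm x).2

theorem ord_lt_ord {x y : OmegaOne.{u}} : x.ord < y.ord ↔ x < y :=
  Ordinal.ToType.mk.symm.lt_iff_lt (x := x) (y := y)

theorem ord_injective : Function.Injective ord.{u} := fun _ _ h =>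
  Ordinal.ToType.mk.symm.injective (Subtype.ext h)

theorem exists_ord_eq {α : Ordinal.{u}} (h : α < Ordinal.omega 1) :
    ∃ x : OmegaOne.{u}, x.ord = α :=
  ⟨Ordinal.ToType.mk ⟨α, h⟩, by simp [ord]⟩

theorem mk_eq : Cardinal.mk OmegaOne.{u} = Cardinal.aleph 1 := by
  rw [Cardinal.mk_toType, Ordinal.card_omega]

instance : Uncountable OmegaOne.{u} := by
  rw [← Cardinal.aleph0_lt_mk_iff, mk_eq, ← Cardinal.aleph_zero]
  exact Cardinal.aleph_lt_aleph.2 zero_lt_one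

theorem countable_Iio {α : Ordinal.{u}} (h : α < Ordinal.omega 1) : (Set.Iio α).Countable := by
  rw [← Cardinal.le_aleph0_iff_set_countable]
  rw [Cardinal.mk_Iio_ordinal, Cardinal.lift_le_aleph0]
  have := Cardinal.lt_omega_iff_card_lt.1 h
  rwa [← Cardinal.succ_aleph0, Order.lt_succ_iff] at this

theorem countable_Iic (x : OmegaOne.{u}) : (Set.Iic x).Countable := by
  refine ((countable_Iio x.ord_lt).preimage ord_injective).insert x |>.mono fun y hy => ?_
  rcases (Set.mem_Iic.1 hy).eq_or_lt with h | h
  · exact Or.inl h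
  · exact Or.inr (ord_lt_ord.2 h)

/-- This supplies the reals for the codes; it holds since `ℵ₁ ≤ 2^ℵ₀`. -/
theorem exists_real_injection : ∃ r : OmegaOne.{u} → Set ℕ, Function.Injective r := by
  have h : Cardinal.lift.{0} (Cardinal.mk OmegaOne.{u}) ≤
      Cardinal.lift.{u} (Cardinal.mk (Set ℕ)) := by
    rw [mk_eq]
    simpa using Cardinal.aleph_one_le_continuum
  obtain ⟨f⟩ := Cardinal.lift_mk_le'.1 h
  exact ⟨f, f.injective⟩

end OmegaOne

namespace Cond

variable {k : ℕ}

theorem mk_eq_aleph_one : Cardinal.mk (Cond k OmegaOne.{u}) = Cardinal.aleph 1 := by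
  apply le_antisymm
  · have h : Function.Injective (fun p : Cond k OmegaOne.{u} => (p.dom, p.fam, p.lnk)) :=
      fun p q h => by
        simp only [Prod.mk.injEq] at h
        exact Cond.ext h.1 h.2.1 h.2.2
    refine (Cardinal.mk_le_of_injective h).trans ?_
    have h0 := Cardinal.aleph0_le_aleph.{u} 1
    have h1 : Cardinal.mk (Finset OmegaOne.{u}) = Cardinal.aleph 1 := by
      rw [Cardinal.mk_finset_of_infinite, OmegaOne.mk_eq]
    simp only [Cardinal.mk_prod, Cardinal.lift_id, Cardinal.mk_finset_of_infinite, h1]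
    simp [h0]
  · rw [← OmegaOne.mk_eq]
    refine Cardinal.mk_le_of_injective (f := fun x => ofFinset k {x}) fun x y h => ?_
    simpa [ofFinset] using congrArg Cond.dom h

/-- An uncountable set has uncountably many members of one code, and these are centred by
amalgamation with no new sets. -/
theorem precalibreAlephOne (hk : k ≠ 0) : PrecalibreAlephOne (Cond k OmegaOne.{u}) := by
  obtain ⟨r, hr⟩ := OmegaOne.exists_real_injection
  obtain ⟨T, hT, c, hc⟩ := exists_code (k := k) r hr hk
  intro S hS
  obtain ⟨t, ht⟩ : ∃ t, ¬ (S ∩ c ⁻¹' {t}).Countable := by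
    by_contra! h
    refine hS ((Set.countable_iUnion h).mono fun p hp => ?_)
    simpa using hp
  refine ⟨_, Set.inter_subset_left, ht, fun F hF => ?_⟩
  obtain ⟨q, hq, -⟩ := hc F id (fun p hp q hq => (hF hp).2.trans (hF hq).2.symm) ∅
    (by simp) (by simp) (by simp)
  exact ⟨q, hq⟩

end Cond
end Forcing

/-! ### Names of finite sets of countable ordinals; preservation of `ℵ₁`. -/

namespace Forcing

section SetNames

variable {P : Type u}

/-- The canonical name of a finite set of countable ordinals. -/
noncomputable def setName (v : Finset OmegaOne.{u}) : PName P :=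
  .mk ({x // x ∈ v} × P) (fun i => ordName i.1.1.ord) Prod.snd

variable [PartialOrder P]

theorem fmem_omegaOne (x : OmegaOne.{u}) (p : P) :
    (ordName x.ord ∊ (ordName (Ordinal.omega 1) : PName P)) p :=
  fmem_ordName_intro x.ord_lt p

theorem fmem_omegaOne_elim {z : PName P} {ψ : Sent P} [Reg ψ] {p : P}
    (h : (z ∊ ordName (Ordinal.omega 1)) p)
    (h' : ∀ q ≤ p, ∀ x : OmegaOne.{u}, (z ≐ ordName x.ord) q → ψ q) : ψ p := by
  refine fmem_ordName_elim h fun q hq β hβ hx => ?_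
  obtain ⟨x, rfl⟩ := OmegaOne.exists_ord_eq hβ
  exact h' q hq x hx

theorem fmem_setName_intro {v : Finset OmegaOne.{u}} {x : OmegaOne.{u}} (h : x ∈ v) (p : P) :
    (ordName x.ord ∊ (setName v : PName P)) p :=
  fmem_mk_intro (⟨x, h⟩, p) le_rfl (feq_refl _ _)

theorem fmem_setName_elim {z : PName P} {v : Finset OmegaOne.{u}} {ψ : Sent P} [Reg ψ] {p : P}
    (h : (z ∊ setName v) p) (h' : ∀ q ≤ p, ∀ x ∈ v, (z ≐ ordName x.ord) q → ψ q) : ψ p :=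
  fmem_mk_elim h fun q hq i _ hx => h' q hq i.1.1 i.1.2 hx

theorem fmem_setName_iff {v : Finset OmegaOne.{u}} {x : OmegaOne.{u}} {p : P} :
    (ordName x.ord ∊ (setName v : PName P)) p ↔ x ∈ v :=
  ⟨fun h => fmem_setName_elim (ψ := fun _ => x ∈ v) h fun _ _ _ hy hxy =>
    OmegaOne.ord_injective (ordName_inj hxy) ▸ hy, fun h => fmem_setName_intro h p⟩

theorem fsub_setName_iff {v w : Finset OmegaOne.{u}} {p : P} :
    fsub (setName v : PName P) (setName w) p ↔ v ⊆ w := by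
  refine ⟨fun h x hx => ?_, fun h z q _ hz => ?_⟩
  · exact fmem_setName_iff.1 (h _ p le_rfl (fmem_setName_intro hx p))
  · exact fmem_setName_elim hz fun r _ x hx hzx =>
      fmem_congr_left (feq_symm hzx) (fmem_setName_intro (h hx) r)

theorem setName_inj {v w : Finset OmegaOne.{u}} {p : P}
    (h : ((setName v : PName P) ≐ setName w) p) :
    v = w :=
  (fsub_setName_iff.1 (fsub_congr (feq_refl _ _) h (fsub_setName_iff.2 subset_rfl))).antisymm
    (fsub_setName_iff.1 (fsub_congr h (feq_refl _ _) (fsub_setName_iff.2 subset_rfl)))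

theorem fsub_setName_ordName_iff {v : Finset OmegaOne.{u}} {α : Ordinal.{u}} {p : P} :
    fsub (setName v : PName P) (ordName α) p ↔ ∀ x ∈ v, x.ord < α := by
  refine ⟨fun h x hx => ?_, fun h z q _ hz => ?_⟩
  · exact fmem_ordName_iff.1 (h _ p le_rfl (fmem_setName_intro hx p))
  · exact fmem_setName_elim hz fun r _ x hx hzx =>
      fmem_congr_left (feq_symm hzx) (fmem_ordName_intro (h x hx) r)

theorem fsub_setName_omegaOne (v : Finset OmegaOne.{u}) (p : P) :
    fsub (setName v : PName P) (ordName (Ordinal.omega 1)) p :=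
  fsub_setName_ordName_iff.2 fun x _ => x.ord_lt

theorem hasCard_setName (v : Finset OmegaOne.{u}) (p : P) :
    HasCard v.card (setName v : PName P) p := by
  refine fex_intro (fun i => ordName (v.equivFin.symm i).1.ord) ⟨fun i j hij q _ hq => ?_,
    fun z => fiff_of fun q _ => ⟨fun h => ?_, fun h => ?_⟩⟩
  · exact hij (v.equivFin.symm.injective (Subtype.ext (OmegaOne.ord_injective (ordName_inj hq))))
  · refine fmem_setName_elim h fun r _ x hx hz => fex_intro (v.equivFin ⟨x, hx⟩) ?_
    simpa using hz
  · exact fex_elim h fun r _ i hi =>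
      fmem_congr_left (feq_symm hi) (fmem_setName_intro (v.equivFin.symm i).2 r)

theorem isFin_setName (v : Finset OmegaOne.{u}) (p : P) : IsFin (setName v : PName P) p :=
  fex_elim (hasCard_setName v p) fun _ _ t h => fex_intro v.card (fex_intro t h.2)

/-- Forcing adds no finite sets of ordinals: the finitely many terms of an enumeration can be
decided simultaneously. -/
theorem exists_setName {x : PName P} {p : P} (h : fsub x (ordName (Ordinal.omega 1)) p)
    (hx : IsFin x p) : fex (fun v : Finset OmegaOne.{u} => x ≐ setName v) p := by
  classical
  refine fex_elim hx fun q hq n hn => fex_elim hn fun r hr t ht => ?_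
  have h1 : ∀ i, fex (fun y : OmegaOne.{u} => t i ≐ ordName y.ord) r := fun i => by
    have : (t i ∊ x) r := (fiff_iff (ht (t i)) le_rfl).2 (fex_intro i (feq_refl _ _))
    exact fmem_omegaOne_elim (h (t i) r (hr.trans hq) this) fun s _ y hy => fex_intro y hy
  refine fex_elim (fex_choice (fun _ _ _ _ => Reg.mono) h1) fun s hs f hf =>
    fex_intro (Finset.univ.image f) ?_
  refine feq_of_ext fun q' hq' z => (fiff_iff (ht z) (hq'.trans hs)).trans
    ⟨fun h => ?_, fun h => ?_⟩
  · exact fex_elim h fun r' hr' i hi => fmem_congr_left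
      (feq_symm (feq_trans hi (Reg.mono (hr'.trans hq') (hf i))))
      (fmem_setName_intro (Finset.mem_image_of_mem f (Finset.mem_univ i)) r')
  · refine fmem_setName_elim h fun r' hr' y hy hz => ?_
    obtain ⟨i, -, rfl⟩ := Finset.mem_image.1 hy
    exact fex_intro i (feq_trans hz (feq_symm (Reg.mono (hr'.trans hq') (hf i))))

theorem isUnionOf_setName {n : ℕ} {s : PName P} {w : Fin n → PName P}
    {v : Fin n → Finset OmegaOne.{u}} {p : P} (h : IsUnionOf s w p)
    (hw : ∀ i, (w i ≐ setName (v i)) p) : (s ≐ setName (Finset.univ.biUnion v)) p := by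
  refine feq_of_ext fun q hq z => (fiff_iff (h z) hq).trans ⟨fun h => ?_, fun h => ?_⟩
  · refine fex_elim h fun r hr i hi => ?_
    refine fmem_setName_elim (fmem_congr_right (Reg.mono (hr.trans hq) (hw i)) hi)
      fun t _ x hx hz => ?_
    exact fmem_congr_left (feq_symm hz)
      (fmem_setName_intro (Finset.mem_biUnion.2 ⟨i, Finset.mem_univ i, hx⟩) t)
  · refine fmem_setName_elim h fun r hr x hx hz => ?_
    obtain ⟨i, -, hx⟩ := Finset.mem_biUnion.1 hx
    exact fex_intro i (fmem_congr_left (feq_symm hz)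
      (fmem_congr_right (feq_symm (Reg.mono (hr.trans hq) (hw i))) (fmem_setName_intro hx r)))

/-- The canonical name of the restriction of `g` to `{y | y < x}`. -/
noncomputable def graphName (x : OmegaOne.{u}) (g : OmegaOne.{u} → ℕ) : PName P :=
  .mk (Set.Iio x × P) (fun i => opair (ordName i.1.1.ord) (ordName (g i.1.1 : Ordinal))) Prod.snd

theorem isCountable_ord (x : OmegaOne.{u}) (p : P) : IsCountable (ordName x.ord : PName P) p := by
  obtain ⟨g, hg⟩ := Set.countable_iff_exists_injOn.1
    ((OmegaOne.countable_Iic x).mono Set.Iio_subset_Iic_self)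
  have elim : ∀ {ψ : Sent P} [Reg ψ] {a b : PName P} {q : P},
      (opair a b ∊ (graphName x g : PName P)) q →
      (∀ r ≤ q, ∀ y < x, (a ≐ ordName y.ord) r → (b ≐ ordName (g y : Ordinal)) r → ψ r) → ψ q :=
    fun h h' => fmem_mk_elim h fun r hr i _ hx =>
      h' r hr i.1.1 i.1.2 (opair_inj hx).1 (opair_inj hx).2
  have mem : ∀ {y : OmegaOne.{u}} {a : PName P} {q : P}, (a ≐ ordName y.ord) q → y < x →
      (a ∊ (ordName x.ord : PName P)) q := fun h hy =>
    fmem_congr_left (feq_symm h) (fmem_ordName_intro (OmegaOne.ord_lt_ord.2 hy) _)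
  refine fex_intro (graphName x g) ⟨⟨fun z q _ hz => ?_, fun a q _ ha => ?_, fun a b b' q _ h => ?_⟩,
    fun a b q _ h => ?_, fun a a' b q _ h => ?_⟩
  · exact fmem_mk_elim hz fun r _ i _ hx => fex_intro (ordName i.1.1.ord)
      (fex_intro (ordName (g i.1.1 : Ordinal)) ⟨mem (feq_refl _ _) i.1.2, hx⟩)
  · refine fmem_ordName_elim ha fun r _ β hβ haβ => ?_
    obtain ⟨y, rfl⟩ := OmegaOne.exists_ord_eq (hβ.trans x.ord_lt)
    exact fex_intro (ordName (g y : Ordinal))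
      (fmem_mk_intro (⟨y, OmegaOne.ord_lt_ord.1 hβ⟩, r) le_rfl (opair_congr haβ (feq_refl _ _)))
  · refine elim h.1 fun r hr y _ hy hb => elim (Reg.mono hr h.2) fun s hs y' _ hy' hb' => ?_
    have := OmegaOne.ord_injective (ordName_inj (feq_trans (feq_symm (Reg.mono hs hy)) hy'))
    subst this
    exact feq_trans (Reg.mono hs hb) (feq_symm hb')
  · exact elim h fun r _ y _ _ hb =>
      fmem_congr_left (feq_symm hb) (fmem_ordName_intro (Ordinal.natCast_lt_omega0 _) r)
  · refine elim h.1 fun r hr y hyx hy hb => elim (Reg.mono hr h.2) fun s hs y' hyx' hy' hb' => ?_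
    have := ordName_inj (feq_trans (feq_symm (Reg.mono hs hb)) hb')
    have := hg hyx hyx' (by exact_mod_cast this)
    subst this
    exact feq_trans (Reg.mono hs hy) (feq_symm hy')

/-- A forcing notion that is a countable union of pairwise compatible pieces preserves `ℵ₁`. -/
theorem isAlephOne_omegaOne {T : Type*} [Countable T] (c : P → T)
    (hc : ∀ p q, c p = c q → ∃ r, r ≤ p ∧ r ≤ q) :
    Forced (IsAlephOne (ordName (Ordinal.omega 1) : PName P)) := by
  refine fun p => ⟨isTrans_ordName _ p, fun x q _ hx => ?_, fun q _ hq => ?_, fun x q _ hx => ?_⟩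
  · exact fmem_ordName_elim hx fun r _ β _ h => isTrans_congr (feq_symm h) (isTrans_ordName β r)
  · obtain ⟨r, -, f, hf, hω, hinj⟩ := hq q le_rfl
    have : ∀ x : OmegaOne.{u}, ∃ s ≤ r, ∃ n : ℕ, (opair (ordName x.ord) (ordName n) ∊ f) s :=
      fun x => by
        obtain ⟨s, hs, y, hy⟩ := hf.2.1 _ r le_rfl (fmem_omegaOne x r) r le_rfl
        have : fex (fun n : ℕ => opair (ordName x.ord) (ordName n) ∊ f) s :=
          fmem_omega0_elim (hω _ y s hs hy) fun t ht n hn => fex_intro n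
            (fmem_congr_left (opair_congr (feq_refl _ _) hn) (Reg.mono ht hy))
        obtain ⟨t, ht, n, hn⟩ := this s le_rfl
        exact ⟨t, ht.trans hs, n, hn⟩
    choose s hs n hn using this
    -- Pigeonhole on the code of the deciding condition and the decided value. Two deciding
    -- conditions that agree in both are compatible, which contradicts the injectivity of `f`.
    have : ¬ Function.Injective fun x => (c (s x), n x) := fun h => by
      have := h.countable
      exact not_countable this
    simp only [Function.Injective, not_forall] at this
    obtain ⟨x, y, hxy, hne⟩ := this
    obtain ⟨t, htx, hty⟩ := hc _ _ (Prod.mk.inj hxy).1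
    have hnn := (Prod.mk.inj hxy).2
    have := hinj (ordName x.ord) (ordName y.ord) (ordName (n x)) t (htx.trans (hs x))
      ⟨Reg.mono htx (hn x), hnn ▸ Reg.mono hty (hn y)⟩
    exact hne (OmegaOne.ord_injective (ordName_inj this))
  · exact fmem_omegaOne_elim hx fun r _ y h => isCountable_congr (feq_symm h) (isCountable_ord y r)

end SetNames

/-! ### The generic family, its free sets and their colouring. -/

section Generic

variable {k : ℕ}

/-- The name of the union of the families of the conditions in the generic filter. -/
noncomputable def famName (k : ℕ) : PName (Cond k OmegaOne.{u}) :=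
  .mk {z : Finset OmegaOne.{u} × Cond k OmegaOne.{u} // z.1 ∈ z.2.fam}
    (fun z => setName z.1.1) (fun z => z.1.2)

/-- The name of the poset of the finite free sets. -/
noncomputable def freeName (k : ℕ) : PName (Cond k OmegaOne.{u}) :=
  .mk {z : Finset OmegaOne.{u} × Cond k OmegaOne.{u} // z.2.Free z.1}
    (fun z => setName z.1.1) (fun z => z.1.2)

/-- The name of the generic colouring of the free sets. -/
noncomputable def lnkName (k : ℕ) : PName (Cond k OmegaOne.{u}) :=
  .mk {z : (Finset OmegaOne.{u} × ℕ) × Cond k OmegaOne.{u} // z.1 ∈ z.2.lnk}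
    (fun z => opair (setName z.1.1.1) (ordName (z.1.1.2 : Ordinal))) (fun z => z.1.2)

variable {p : Cond k OmegaOne.{u}} {z : PName (Cond k OmegaOne.{u})}
  {ψ : Sent (Cond k OmegaOne.{u})}

theorem fmem_famName_intro {a : Finset OmegaOne.{u}} (h : a ∈ p.fam) :
    (setName a ∊ famName k) p :=
  fmem_mk_intro ⟨(a, p), h⟩ le_rfl (feq_refl _ _)

theorem fmem_famName_elim [Reg ψ] (h : (z ∊ famName k) p)
    (h' : ∀ q ≤ p, ∀ a ∈ q.fam, (z ≐ setName a) q → ψ q) : ψ p :=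
  fmem_mk_elim h fun q hq i hi hz => h' q hq i.1.1 (Cond.fam_mono hi i.2) hz

theorem fmem_freeName_intro {v : Finset OmegaOne.{u}} (h : p.Free v) :
    (setName v ∊ freeName k) p :=
  fmem_mk_intro ⟨(v, p), h⟩ le_rfl (feq_refl _ _)

theorem fmem_freeName_elim [Reg ψ] (h : (z ∊ freeName k) p)
    (h' : ∀ q ≤ p, ∀ v, q.Free v → (z ≐ setName v) q → ψ q) : ψ p :=
  fmem_mk_elim h fun q hq i hi hz => h' q hq i.1.1 (i.2.mono hi) hz

theorem fmem_lnkName_intro {v : Finset OmegaOne.{u}} {n : ℕ} (h : (v, n) ∈ p.lnk) :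
    (opair (setName v) (ordName (n : Ordinal)) ∊ lnkName k) p :=
  fmem_mk_intro ⟨((v, n), p), h⟩ le_rfl (feq_refl _ _)

theorem fmem_lnkName_elim [Reg ψ] (h : (z ∊ lnkName k) p)
    (h' : ∀ q ≤ p, ∀ v n, (v, n) ∈ q.lnk →
      (z ≐ opair (setName v) (ordName (n : Ordinal))) q → ψ q) : ψ p :=
  fmem_mk_elim h fun q hq i hi hz => h' q hq i.1.1.1 i.1.1.2 (Cond.lnk_mono hi i.2) hz

theorem isFamilyOfSubsets_famName :
    Forced (IsFamilyOfSubsets (k + 1) (ordName (Ordinal.omega 1)) (famName.{u} k)) :=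
  fun _ _ _ _ ha => fmem_famName_elim ha fun q _ b hb hab =>
    ⟨fsub_congr (feq_symm hab) (feq_refl _ _) (fsub_setName_omegaOne b q),
      hasCard_congr (feq_symm hab) (q.fam_card b hb ▸ hasCard_setName b q)⟩

theorem isFreeSets_freeName :
    Forced (IsFreeSets (k + 1) (ordName (Ordinal.omega 1)) (famName.{u} k) (freeName k)) := by
  refine fun p v => fiff_of fun q hq => ⟨fun h => ?_, fun h => ?_⟩
  · refine fmem_freeName_elim h fun r _ w hw hv => ⟨?_, ?_, fun a s hs ha t ht ham => ?_⟩
    · exact fsub_congr (feq_symm hv) (feq_refl _ _) (fsub_setName_omegaOne w r)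
    · exact isFin_congr (feq_symm hv) (isFin_setName w r)
    · refine fmem_famName_elim (ψ := fun _ => False) ham fun q' hq' b hb hab => ?_
      have : fsub (setName b) (setName w) q' :=
        fsub_congr hab (Reg.mono (hq'.trans (ht.trans hs)) hv) (Reg.mono (hq'.trans ht) ha.1)
      exact (hw.mono (hq'.trans (ht.trans hs))).2 b hb (fsub_setName_iff.1 this)
  · refine fex_elim (exists_setName h.1 h.2.1) fun r hr w hw => ?_
    -- Once `w` lies in the domain, the condition decides whether `w` is free; a member of `fam`
    -- inside `w` would contradict the hypothesis.
    refine Reg.dense fun s hs => ⟨s.extend w, s.extend_le w, ?_⟩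
    have hsr := (s.extend_le w).trans hs
    have hw' := Reg.mono hsr hw
    refine fmem_congr_left (feq_symm hw')
      (fmem_freeName_intro ⟨Finset.subset_union_right, fun a ha haw => ?_⟩)
    have hcard : HasCard (k + 1) (setName a) (s.extend w) :=
      (s.extend w).fam_card a ha ▸ hasCard_setName a _
    exact h.2.2 (setName a) _ (hsr.trans hr)
      ⟨fsub_congr (feq_refl _ _) (feq_symm hw') (fsub_setName_iff.2 haw), hcard⟩ _ le_rfl
      (fmem_famName_intro ha)

/-- The witness is the generic colouring: it is total by `exists_le_lnk`, and `lnk_free` says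
exactly that the union of `k` sets of one colour is free. -/
theorem isLinked_freeName (hk : k ≠ 0) : Forced (IsLinked k (freeName.{u} k)) := by
  refine fun p => fex_intro (lnkName k) ⟨⟨fun z q _ hz => ?_, fun a q _ ha => ?_,
    fun a b b' q _ h => ?_⟩, fun a b q _ h => ?_, fun w n q _ h => ?_⟩
  · exact fmem_lnkName_elim hz fun r _ v n hv hx => fex_intro (setName v)
      (fex_intro (ordName (n : Ordinal))
        ⟨fmem_freeName_intro (Cond.free_of_mem_lnk hk hv), hx⟩)
  · refine fmem_freeName_elim ha fun r _ v hv hav => Reg.dense fun s hs => ?_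
    obtain ⟨t, ht, n, hn⟩ := s.exists_le_lnk (hv.mono hs)
    exact ⟨t, ht, fex_intro (ordName (n : Ordinal)) (fmem_congr_left
      (opair_congr (feq_symm (Reg.mono (ht.trans hs) hav)) (feq_refl _ _))
      (fmem_lnkName_intro hn))⟩
  · refine fmem_lnkName_elim h.1 fun r hr v n hv hx =>
      fmem_lnkName_elim (Reg.mono hr h.2) fun s hs v' n' hv' hx' => ?_
    obtain ⟨h1, h2⟩ := opair_inj (Reg.mono hs hx)
    obtain ⟨h1', h2'⟩ := opair_inj hx'
    have := setName_inj (feq_trans (feq_symm h1) h1')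
    subst this
    have := s.lnk_fun v n n' (Cond.lnk_mono hs hv) hv'
    subst this
    exact feq_trans h2 (feq_symm h2')
  · exact fmem_lnkName_elim h fun r _ v n _ hx => fmem_congr_left (feq_symm (opair_inj hx).2)
      (fmem_ordName_intro (Ordinal.natCast_lt_omega0 n) r)
  · have : ∀ i, fex (fun (x : Finset OmegaOne.{u} × ℕ) => (fun r => x ∈ r.lnk) ⋏
        w i ≐ setName x.1 ⋏ n ≐ ordName (x.2 : Ordinal)) q := fun i => by
      refine fmem_lnkName_elim (h i) fun r _ v m hv hx => ?_
      intro s hs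
      exact ⟨s, le_rfl, (v, m), Cond.lnk_mono hs hv, Reg.mono hs (opair_inj hx).1,
        Reg.mono hs (opair_inj hx).2⟩
    refine fex_elim (fex_choice (fun i x r s hs h => ⟨Cond.lnk_mono hs h.1, Reg.mono hs h.2⟩) this)
      fun r _ f hf => ?_
    have hn : ∀ i, (f i).2 = (f ⟨0, Nat.pos_of_ne_zero hk⟩).2 := fun i => by
      exact_mod_cast ordName_inj (feq_trans (feq_symm (hf i).2.2) (hf _).2.2)
    have hmem : ∀ i, ((f i).1, (f ⟨0, Nat.pos_of_ne_zero hk⟩).2) ∈ r.lnk := fun i =>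
      hn i ▸ (hf i).1
    refine fex_intro (setName (Finset.univ.biUnion fun i => (f i).1))
      ⟨fmem_freeName_intro ⟨?_, fun a ha hsub => ?_⟩, fun i => ?_⟩
    · exact Finset.biUnion_subset.2 fun i _ => r.lnk_sub _ _ (hf i).1
    · obtain ⟨x, hx, hxw⟩ := r.lnk_free _ _ hmem a ha
      obtain ⟨i, -, hi⟩ := Finset.mem_biUnion.1 (hsub hx)
      exact hxw i hi
    · exact fsub_congr (feq_symm (hf i).2.1) (feq_refl _ _) (fsub_setName_iff.2
        (Finset.subset_biUnion_of_mem (fun i => (f i).1) (Finset.mem_univ i)))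

/-- A point outside the domain can be added to any free set, since no member of the current family
contains it. -/
theorem allDense_freeName : Forced (AllDense (ordName (Ordinal.omega 1)) (freeName.{u} k)) := by
  intro p α q _ hα v r hr hv
  refine fmem_omegaOne_elim (Reg.mono hr hα) fun s hs x hx => ?_
  refine fmem_freeName_elim (Reg.mono hs hv) fun t ht w hw hvw => ?_
  refine Reg.dense fun t' ht' => ?_
  obtain ⟨y, hxy, hy⟩ : ∃ y, x ≤ y ∧ y ∉ t'.dom := by
    by_contra! h
    refine Set.not_countable_univ (α := OmegaOne.{u}) (((OmegaOne.countable_Iic x).union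
      t'.dom.countable_toSet).mono fun y _ => ?_)
    exact (le_total y x).imp id (h y)
  refine ⟨t'.extend {y}, t'.extend_le {y}, fex_intro (setName (insert y w))
    ⟨fmem_freeName_intro ⟨?_, fun a ha haw => ?_⟩, fun q hq hsub => ?_, ?_⟩⟩
  · refine Finset.insert_subset (Finset.mem_union_right _ (Finset.mem_singleton_self y)) ?_
    exact (hw.mono ht').1.trans Finset.subset_union_left
  · refine (hw.mono ht').2 a ha fun z hz => (Finset.mem_insert.1 (haw hz)).resolve_left ?_
    rintro rfl
    exact hy (t'.fam_sub a ha hz)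
  · have := fsub_congr (feq_refl _ _)
      (Reg.mono ((hq.trans (t'.extend_le {y})).trans (ht'.trans ht)) hx) hsub
    have := fsub_setName_ordName_iff.1 this y (Finset.mem_insert_self y w)
    exact (OmegaOne.ord_lt_ord.1 this).not_ge hxy
  · exact fsub_congr (feq_symm (Reg.mono ((t'.extend_le {y}).trans ht') hvw)) (feq_refl _ _)
      (fsub_setName_iff.2 (Finset.subset_insert y w))

end Generic
end Forcing

namespace Forcing

/-! ### Separating point-countable families of finite sets. -/

section Combinatorics

variable {U Z : OmegaOne.{u} → Finset OmegaOne.{u}}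

/-- A finite set meets only countably many `Z η`, so only the disjointness of `Z ξ` and `U η` is at
issue. If every `ξ` failed, each `Z ξ` would meet all but countably many `U η`. Infinitely many
pairwise disjoint `Z (f n)` would then all meet a single finite `U ξ`. -/
theorem exists_uncountable_disjoint {S : Set OmegaOne.{u}} (hS : ¬ S.Countable)
    (hZ : ∀ β, {ξ ∈ S | β ∈ Z ξ}.Countable) :
    ∃ ξ ∈ S, ¬ {η ∈ S | ξ < η ∧ Disjoint (Z ξ) (U η) ∧ Disjoint (Z η) (U ξ)}.Countable := by
  have hmeet : ∀ F : Finset OmegaOne.{u}, {η ∈ S | ¬ Disjoint (Z η) F}.Countable := fun F => by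
    refine (F.countable_toSet.biUnion fun β _ => hZ β).mono fun η hη => ?_
    obtain ⟨β, h1, h2⟩ := Finset.not_disjoint_iff.1 hη.2
    exact Set.mem_biUnion h2 ⟨hη.1, h1⟩
  by_contra! hcon
  have hcount : ∀ ξ ∈ S, {η ∈ S | Disjoint (Z ξ) (U η)}.Countable := fun ξ hξ => by
    refine ((hcon ξ hξ).union ((OmegaOne.countable_Iic ξ).union (hmeet (U ξ)))).mono fun η hη => ?_
    by_cases h1 : η ≤ ξ
    · exact Or.inr (Or.inl h1)
    by_cases h2 : Disjoint (Z η) (U ξ)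
    · exact Or.inl ⟨hη.1, not_le.1 h1, hη.2, h2⟩
    · exact Or.inr (Or.inr ⟨hη.1, h2⟩)
  obtain ⟨f, hf, hd⟩ := exists_seq_of_forall_finset_exists (· ∈ S)
    (fun x y => Disjoint (Z x) (Z y)) fun s _ => by
      classical
      by_contra! h
      refine hS ((hmeet (s.biUnion Z)).mono fun η hη => Set.mem_sep hη fun hdis => ?_)
      obtain ⟨x, hx, hxη⟩ := h η hη
      exact hxη ((Finset.disjoint_biUnion_right _ _ _).1 hdis x hx).symm
  obtain ⟨ξ, hξ, hξf⟩ : ∃ ξ ∈ S, ∀ n, ¬ Disjoint (Z (f n)) (U ξ) := by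
    by_contra! h
    exact hS ((Set.countable_iUnion fun n => hcount (f n) (hf n)).mono fun ξ hξ => by
      obtain ⟨n, hn⟩ := h ξ hξ
      exact Set.mem_iUnion.2 ⟨n, hξ, hn⟩)
  choose g hg hgU using fun n => Finset.not_disjoint_iff.1 (hξf n)
  have hinj : Function.Injective g := fun m n h => by
    rcases lt_trichotomy m n with hmn | hmn | hmn
    · exact (Finset.disjoint_left.1 (hd m n hmn) (hg m) (h ▸ hg n)).elim
    · exact hmn
    · exact (Finset.disjoint_left.1 (hd n m hmn) (hg n) (h ▸ hg m)).elim
  exact Set.infinite_range_of_injective hinj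
    ((U ξ).finite_toSet.subset (Set.range_subset_iff.2 hgU))

/-- Iterate the previous lemma, each time continuing inside the uncountable set of good partners. -/
theorem exists_strictMono_disjoint (n : ℕ) {S : Set OmegaOne.{u}} (hS : ¬ S.Countable)
    (hZ : ∀ β, {ξ ∈ S | β ∈ Z ξ}.Countable) :
    ∃ ξ : Fin n → OmegaOne.{u}, StrictMono ξ ∧ (∀ i, ξ i ∈ S) ∧
      ∀ i j, i ≠ j → Disjoint (Z (ξ i)) (U (ξ j)) := by
  induction n generalizing S with
  | zero => exact ⟨Fin.elim0, fun i => i.elim0, fun i => i.elim0, fun i => i.elim0⟩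
  | succ n ih =>
    obtain ⟨ξ₀, hξ₀, hT⟩ := exists_uncountable_disjoint (U := U) hS hZ
    obtain ⟨ξ, hξ, hmem, hd⟩ := ih hT fun β => (hZ β).mono fun η hη => Set.mem_sep hη.1.1 hη.2
    refine ⟨Fin.cons ξ₀ ξ, ?_, ?_, ?_⟩
    · refine Fin.cases (Fin.cases (fun h => (lt_irrefl _ h).elim) fun j _ => (hmem j).2.1)
        fun i => Fin.cases (fun h => (Fin.not_lt_zero _ h).elim) fun j h => ?_
      exact hξ (Fin.succ_lt_succ_iff.1 h)
    · exact Fin.cases hξ₀ fun i => (hmem i).1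
    · refine Fin.cases (Fin.cases (fun h => (h rfl).elim) fun j _ => (hmem j).2.2.1)
        fun i => Fin.cases (fun _ => (hmem i).2.2.2) fun j h => hd i j fun hij => h (by rw [hij])

end Combinatorics

/-! ### The unions that leave the poset. -/

section Unions

variable {k : ℕ} {p : Cond k OmegaOne.{u}} {u v : PName (Cond k OmegaOne.{u})}

/-- The set `u_ξ` is finite, so one extension decides it together with all `v_α` for `α` in it. The
point `β ≥ α` exists because `v_α ⊈ α`. -/
theorem exists_decision (hv : IsSelection (ordName (Ordinal.omega 1)) (freeName k) v p)
    (hu : IsDisjointSeq (ordName (Ordinal.omega 1)) u p) (ξ : OmegaOne.{u}) :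
    ∃ q ≤ p, ∃ (a : Finset OmegaOne.{u}) (f : OmegaOne.{u} → Finset OmegaOne.{u}), a.Nonempty ∧
      (opair (ordName ξ.ord) (setName a) ∊ u) q ∧
      ∀ α ∈ a, (opair (ordName α.ord) (setName (f α)) ∊ v) q ∧ q.Free (f α) ∧ ∃ β ∈ f α, α ≤ β := by
  have h1 : fex (fun a : Finset OmegaOne.{u} =>
      (fun _ => a.Nonempty) ⋏ opair (ordName ξ.ord) (setName a) ∊ u) p := by
    refine fex_elim (hu.1.2.1 _ p le_rfl (fmem_omegaOne ξ p)) fun q hq y hy => ?_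
    obtain ⟨hsub, hfin, hne⟩ := hu.2.1 _ y q hq hy
    refine fex_elim (exists_setName hsub hfin) fun r hr a ha => fex_elim (Reg.mono hr hne)
      fun s hs b hb => fmem_setName_elim (fmem_congr_right (Reg.mono hs ha) hb)
      fun t ht x hx _ => fex_intro a ⟨⟨x, hx⟩, ?_⟩
    exact fmem_congr_left (opair_congr (feq_refl _ _) (Reg.mono (ht.trans hs) ha))
      (Reg.mono (ht.trans (hs.trans hr)) hy)
  obtain ⟨q, hq, a, hne, ha⟩ := h1 p le_rfl
  have h2 : ∀ α ∈ a, fex (fun w : Finset OmegaOne.{u} =>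
      opair (ordName α.ord) (setName w) ∊ v ⋏ (fun r => r.Free w ∧ ∃ β ∈ w, α ≤ β)) q :=
    fun α _ => by
      refine fex_elim (hv.1.2.1 _ q hq (fmem_omegaOne α q)) fun r hr y hy => ?_
      obtain ⟨hQ, hnot⟩ := hv.2 _ y r (hr.trans hq) hy
      refine fmem_freeName_elim hQ fun s hs w hw hyw t ht => ⟨t, le_rfl, w, ?_, hw.mono ht, ?_⟩
      · exact fmem_congr_left (opair_congr (feq_refl _ _) (Reg.mono ht hyw))
          (Reg.mono (ht.trans hs) hy)
      · by_contra! h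
        refine hnot t (ht.trans hs) (fsub_congr (feq_symm (Reg.mono ht hyw)) (feq_refl _ _) ?_)
        exact fsub_setName_ordName_iff.2 fun x hx => OmegaOne.ord_lt_ord.2 (h x hx)
  obtain ⟨r, hr, f, hf⟩ := fex_finset_choice
    (fun α w s t ht h => ⟨Reg.mono ht h.1, h.2.1.mono ht, h.2.2⟩) a h2 q le_rfl
  exact ⟨r, hr.trans hq, a, f, hne, Reg.mono hr ha, fun α hα => hf α hα⟩

theorem disjoint_of_isDisjointSeq (hu : IsDisjointSeq (ordName (Ordinal.omega 1)) u p)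
    {ξ η : OmegaOne.{u}} (hne : ξ ≠ η) {a b : Finset OmegaOne.{u}}
    (ha : (opair (ordName ξ.ord) (setName a) ∊ u) p)
    (hb : (opair (ordName η.ord) (setName b) ∊ u) p) : Disjoint a b := by
  refine Finset.disjoint_left.2 fun x hxa hxb => ?_
  exact hu.2.2 (ordName ξ.ord) (ordName η.ord) (setName a) (setName b) p le_rfl
    ⟨ha, hb, fun q _ h => hne (OmegaOne.ord_injective (ordName_inj h))⟩ p le_rfl
    (fex_intro (ordName x.ord) ⟨fmem_setName_intro hxa p, fmem_setName_intro hxb p⟩)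

theorem unionsAvoid_freeName (hk : k ≠ 0) :
    Forced (UnionsAvoid k (ordName (Ordinal.omega 1)) (freeName.{u} k)) := by
  intro p₀ v u p _ ⟨hv, hu⟩ p' hp'
  obtain ⟨ρ, hρ⟩ := OmegaOne.exists_real_injection
  obtain ⟨T, hT, c, hc⟩ := Cond.exists_code (k := k) ρ hρ hk
  choose q hq a f hne ha hf using exists_decision (Reg.mono hp' hv) (Reg.mono hp' hu)
  choose! z hz hzle using fun ξ α hα => (hf ξ α hα).2.2
  obtain ⟨t, ht⟩ : ∃ t, ¬ {ξ | c (q ξ) = t}.Countable := by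
    by_contra! h
    exact Set.not_countable_univ ((Set.countable_iUnion h).mono fun ξ _ => by simp)
  -- Conditions of one code are compatible, so the disjointness forced for the `u_ξ` holds for their
  -- decided values.
  have hdisj : ∀ ξ η, c (q ξ) = c (q η) → ξ ≠ η → Disjoint (a ξ) (a η) := fun ξ η hξη hne => by
    obtain ⟨r, hr, -⟩ := hc {ξ, η} q (by simp [hξη]) ∅ (by simp) (by simp) (by simp)
    have h1 := hr ξ (by simp)
    have h2 := hr η (by simp)
    exact disjoint_of_isDisjointSeq (Reg.mono (h1.trans ((hq ξ).trans hp')) hu) hne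
      (Reg.mono h1 (ha ξ)) (Reg.mono h2 (ha η))
  -- If `β` is picked for `α ∈ a ξ`, then `α ≤ β`. Disjointness of the `a ξ` makes `ξ ↦ α` injective
  -- into a countable initial segment.
  have hZ : ∀ β, {ξ ∈ {ξ | c (q ξ) = t} | β ∈ (a ξ).image (z ξ)}.Countable := fun β => by
    have : ∀ ξ, ∃ α, β ∈ (a ξ).image (z ξ) → α ∈ a ξ ∧ α ≤ β := fun ξ => by
      by_cases h : β ∈ (a ξ).image (z ξ)
      · obtain ⟨α, hα, rfl⟩ := Finset.mem_image.1 h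
        exact ⟨α, fun _ => ⟨hα, hzle ξ α hα⟩⟩
      · exact ⟨β, fun h' => (h h').elim⟩
    choose g hg using this
    refine Set.MapsTo.countable_of_injOn (f := g) (t := Set.Iic β)
      (fun ξ hξ => (hg ξ hξ.2).2) (fun ξ hξ η hη h => ?_) (OmegaOne.countable_Iic β)
    by_contra hne
    exact Finset.disjoint_left.1 (hdisj ξ η (hξ.1.trans hη.1.symm) hne) (hg ξ hξ.2).1
      (h ▸ (hg η hη.2).1)
  obtain ⟨ξ, hmono, hmem, hd⟩ := exists_strictMono_disjoint (U := fun ξ => (q ξ).dom) (k + 1) ht hZ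
  have hZU : ∀ ξ, (a ξ).image (z ξ) ⊆ (q ξ).dom := fun ξ => Finset.image_subset_iff.2 fun α hα =>
    (hf ξ α hα).2.1.1 (hz ξ α hα)
  have hdx : ∀ {i j x}, x ∈ (a (ξ i)).image (z (ξ i)) → x ∈ (q (ξ j)).dom → i = j :=
    fun {i j x} hi hj => by_contra fun hij => Finset.disjoint_left.1 (hd i j hij) hi hj
  -- The amalgam receives every transversal of the picked points as a new member of the family.
  obtain ⟨r, hr, hN⟩ := hc (Finset.univ.image ξ) q
    (by simpa using fun i j => (hmem i).trans (hmem j).symm)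
    ((Fintype.piFinset fun i => (a (ξ i)).image (z (ξ i))).image fun x => Finset.univ.image x)
    (by
      refine Finset.forall_mem_image.2 fun x hx => ?_
      rw [Finset.card_image_of_injective, Finset.card_fin]
      exact fun i j hij => hdx (Fintype.mem_piFinset.1 hx i)
        (hij ▸ hZU _ (Fintype.mem_piFinset.1 hx j)))
    (by
      refine Finset.forall_mem_image.2 fun x hx => Finset.image_subset_iff.2 fun i _ => ?_
      exact Finset.mem_biUnion.2 ⟨ξ i, Finset.mem_image_of_mem ξ (Finset.mem_univ i),
        hZU _ (Fintype.mem_piFinset.1 hx i)⟩)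
    (by
      refine Finset.forall_mem_image.2 fun x hx w hw => ?_
      by_contra! h
      -- Pigeonhole: a cover by `k` sets would inject `k+1` points into `k` indices, as each domain
      -- contains at most one of the points.
      choose g hg using fun i => h (x i) (Finset.mem_image_of_mem x (Finset.mem_univ i))
      have hinj : Function.Injective g := fun i j hij => by
        obtain ⟨η, hη, hsub⟩ := hw (g i)
        obtain ⟨l, -, rfl⟩ := Finset.mem_image.1 hη
        rw [hdx (Fintype.mem_piFinset.1 hx i) (hsub (hg i)),
          hdx (Fintype.mem_piFinset.1 hx j) (hsub (hij ▸ hg j))]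
      simpa using Fintype.card_le_of_injective g hinj)
  have hr : ∀ i, r ≤ q (ξ i) := fun i => hr _ (Finset.mem_image_of_mem ξ (Finset.mem_univ i))
  have hrp : r ≤ p' := (hr 0).trans (hq _)
  refine ⟨r, hrp, fun i => ordName (ξ i).ord, fun i => fmem_omegaOne _ r, fun i j hij =>
    fmem_ordName_intro (OmegaOne.ord_lt_ord.2 (hmono hij)) r, fun α y w s r₁ hr₁ h r₂ hr₂ hs => ?_⟩
  obtain ⟨h, hun⟩ := h
  have hα : ∀ i, fex (fun x : OmegaOne.{u} => (fun _ => x ∈ a (ξ i)) ⋏ α i ≐ ordName x.ord) r₂ :=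
    fun i => by
      have hy : (y i ≐ setName (a (ξ i))) r₁ := hu.1.2.2 (ordName (ξ i).ord) _ _ r₁
        (hr₁.trans (hrp.trans hp')) ⟨(h i).1, Reg.mono (hr₁.trans (hr i)) (ha (ξ i))⟩
      exact fmem_setName_elim (fmem_congr_right (Reg.mono hr₂ hy) (Reg.mono hr₂ (h i).2.1))
        fun _ _ x hx hxα => fex_intro x ⟨hx, hxα⟩
  obtain ⟨r₃, hr₃, x, hx⟩ := fex_choice (fun _ _ _ _ h h' => ⟨h'.1, Reg.mono h h'.2⟩) hα r₂ le_rfl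
  have hw : ∀ i, (w i ≐ setName (f (ξ i) (x i))) r₃ := fun i =>
    hv.1.2.2 (α i) _ _ r₃ ((hr₃.trans (hr₂.trans hr₁)).trans (hrp.trans hp'))
      ⟨Reg.mono (hr₃.trans hr₂) (h i).2.2, fmem_congr_left
        (opair_congr (feq_symm (hx i).2) (feq_refl _ _))
        (Reg.mono ((hr₃.trans (hr₂.trans hr₁)).trans (hr i)) (hf (ξ i) (x i) (hx i).1).1)⟩
  have hs' := isUnionOf_setName (Reg.mono (hr₃.trans hr₂) hun) hw
  refine fmem_freeName_elim (ψ := fun _ => False) (Reg.mono hr₃ hs) fun r₄ hr₄ V hV hsV => ?_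
  have hVeq := setName_inj (feq_trans (feq_symm hsV) (Reg.mono hr₄ hs'))
  -- The transversal of the points picked in the chosen `v_α` is in the family and inside the union.
  refine hV.2 (Finset.univ.image fun i => z (ξ i) (x i))
    (Cond.fam_mono (hr₄.trans (hr₃.trans (hr₂.trans hr₁))) (hN (Finset.mem_image_of_mem _
      (Fintype.mem_piFinset.2 fun i => Finset.mem_image_of_mem _ (hx i).1)))) ?_
  rw [hVeq]
  exact Finset.image_subset_iff.2 fun i _ =>
    Finset.mem_biUnion.2 ⟨i, Finset.mem_univ i, hz (ξ i) (x i) (hx i).1⟩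

end Unions

end Forcing

theorem mainTheorem6 (k : ℕ) (hk : 2 ≤ k) :
    ∃ (P : Type u) (_ : PartialOrder P) (𝒜 Q : PName P),
      PrecalibreAlephOne P ∧ Cardinal.mk P = Cardinal.aleph 1 ∧
      Forced (IsAlephOne (ordName (Ordinal.omega 1) : PName P)) ∧
      Forced (IsFamilyOfSubsets (k + 1) (ordName (Ordinal.omega 1)) 𝒜) ∧
      Forced (IsFreeSets (k + 1) (ordName (Ordinal.omega 1)) 𝒜 Q) ∧
      Forced (IsLinked k Q) ∧
      Forced (AllDense (ordName (Ordinal.omega 1)) Q) ∧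
      Forced (UnionsAvoid k (ordName (Ordinal.omega 1)) Q) := by
  have hk : k ≠ 0 := by omega
  obtain ⟨ρ, hρ⟩ := OmegaOne.exists_real_injection
  obtain ⟨T, hT, c, hc⟩ := Cond.exists_code (k := k) ρ hρ hk
  refine ⟨Cond k OmegaOne.{u}, inferInstance, famName k, freeName k, Cond.precalibreAlephOne hk,
    Cond.mk_eq_aleph_one, isAlephOne_omegaOne c fun p q hpq => ?_, isFamilyOfSubsets_famName,
    isFreeSets_freeName, isLinked_freeName hk, allDense_freeName, unionsAvoid_freeName hk⟩
  classical
  obtain ⟨r, hr, -⟩ := hc {p, q} id (by simp [hpq]) ∅ (by simp) (by simp) (by simp)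
  exact ⟨r, hr p (by simp), hr q (by simp)⟩
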